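/- Let $\mathbb M=\mathbb R^4$ be Minkowski space with metric $g=\mathrm{diag}(1,-1,-1,-1)$, let $m\in\mathbb R$, and consider the configuration space $\mathcal C=C^\infty(\mathbb M,\mathbb C)\times C^\infty(\mathbb M,\mathbb R^4)$ with basic fields $\phi(x)[h,a]=h(x)$, $\phi^*(x)[h,a]=\overline{h(x)}$, $A^\mu(x)[h,a]=a^\mu(x)$. Let $\mathcal F_{\rm loc}$ be the complex linear span of the functionals $B(g)=\int dx\,g(x)B(x)$ on $\mathcal C$, where $g\in\mathcal D(\mathbb M)$ and $B$ is a polynomial in $A^\mu,\phi,\phi^*,\partial_\mu\phi,\partial_\mu\phi^*$. For a functional $F$ on $\mathcal C$ let $F_0$ be its restriction to the solutions of the free field equations $(\square+m^2)h=0$, $\square a^\mu=0$. Let $K$ be a field containing $\mathbb C$ and let $0\neq\hbar\in K$ (for example $K=\mathbb C$, $\hbar=1$, or $K=\mathbb C((\hbar))$ with $\hbar$ a formal variable). Let $T=(T_n)_{n\ge1}$ be a sequence of symmetric $\mathbb C$-multilinear maps $T_n:\mathcal F_{\rm loc}^{\,n}\to\{\text{functionals }\mathcal C\to K\}$ with $T_1(F)=F$;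 for example, any time-ordered product of scalar QED satisfying the Action Ward Identity, regarded as a sequence of maps on local fields. Put $$S(F)=1+\sum_{n\ge1}\frac{1}{n!}\Bigl(\frac{i}{\hbar}\Bigr)^{n}T_n(F^{\otimes n}),\qquad T\bigl(G\otimes e^{iF/\hbar}\bigr)=\sum_{n\ge0}\frac1{n!}\Bigl(\frac{i}{\hbar}\Bigr)^{n}T_{n+1}(G\otimes F^{\otimes n}).$$ For $\alpha\in\mathcal D(\mathbb M,\mathbb R)$ and $F\in\mathcal F_{\rm loc}$ put $F_\alpha[h,a]=F[e^{i\alpha}h,a]$, that is, $\phi\mapsto e^{i\alpha}\phi$, $\phi^*\mapsto e^{-i\alpha}\phi^*$ and $A^\mu$ unchanged. Put $\delta L_0(\alpha)=\int dx\,\bigl(L_0(x)_\alpha-L_0(x)\bigr)$, where $L_0=\partial_\mu\phi^*\partial^\mu\phi-m^2\phi^*\phi-\frac14F^{\mu\nu}F_{\mu\nu}$ and $F_{\mu\nu}=\partial_\mu A_\nu-\partial_\nu A_\mu$. Put $(\partial j)(\alpha)=-\int dx\,j^\mu(x)\,\partial_\mu\alpha(x)$ with $j^\mu=i(\phi\,\partial^\mu\phi^*-\phi^*\,\partial^\mu\phi)$.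 Finally put $$\delta_{\alpha Q}F=\int dy\,\alpha(y)\Bigl(Q(y)\frac{\delta F}{\delta\phi(y)}+Q^*(y)\frac{\delta F}{\delta\phi^*(y)}\Bigr),\qquad Q=-i\phi .$$ Then the following two statements are equivalent. 1. (Unitary MWI) For all $F\in\mathcal F_{\rm loc}$ and all $\alpha\in\mathcal D(\mathbb M,\mathbb R)$, $$S\bigl(F_\alpha+\delta L_0(\alpha)\bigr)_0=S(F)_0$$ as formal power series in $F$ and $\alpha$: replace $F$ by $\lambda F$ and $\alpha$ by $t\alpha$, expand $F_{t\alpha}$ and $\delta L_0(t\alpha)$ in their Taylor series in $t$ (whose coefficients lie in $\mathcal F_{\rm loc}$), and compare the coefficients of $\lambda^nt^k$ for all $n,k$. 2. (On-shell MWI) For all $F\in\mathcal F_{\rm loc}$ and all $\alpha\in\mathcal D(\mathbb M,\mathbb R)$, $$T\bigl((\partial j)(\alpha)\otimes e^{iF/\hbar}\bigr)_0=-\,T\bigl(\delta_{\alpha Q}F\otimes e^{iF/\hbar}\bigr)_0$$ as formal power series in $F$: replace $F$ by $\lambda F$ and compare the coefficients of $\lambda^n$ for all $n$. -/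

import Mathlib

open scoped ContDiff Distributions BigOperators Nat

noncomputable section

namespace ScalarQED

/-! ### Minkowski space, test functions and configurations -/

/-- Minkowski space, in inertial coordinates `(x⁰, x¹, x², x³)`. -/
abbrev Mink : Type := Fin 4 → ℝ

/-- The diagonal entries of the Minkowski metric `g = diag(1, -1, -1, -1)`. -/
def metric (μ : Fin 4) : ℝ := if μ = 0 then 1 else -1

/-- The partial derivative `∂_μ f`. -/
def pd {E : Type} [NormedAddCommGroup E] [NormedSpace ℝ E] (μ : Fin 4) (f : Mink → E) (x : Mink) :
    E :=
  fderiv ℝ f x (Pi.single μ 1)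

/-- The wave operator `□ = g^{μν} ∂_μ ∂_ν`. -/
def box {E : Type} [NormedAddCommGroup E] [NormedSpace ℝ E] (f : Mink → E) (x : Mink) : E :=
  ∑ μ, metric μ • pd μ (pd μ f) x

/-- Real test functions on Minkowski space (smooth, compactly supported). -/
abbrev TestR : Type := 𝓓((⊤ : TopologicalSpace.Opens Mink), ℝ)

/-- Complex test functions on Minkowski space. -/
abbrev TestC : Type := 𝓓((⊤ : TopologicalSpace.Opens Mink), ℂ)

/-- The configuration space `C^∞(𝕄, ℂ) × C^∞(𝕄, ℝ⁴)`: a smooth complex scalar configuration and a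
smooth photon configuration. -/
@[ext]
structure Config where
  /-- the scalar configuration `h` -/
  h : Mink → ℂ
  /-- the photon configuration `a^μ` -/
  a : Fin 4 → Mink → ℝ
  smooth_h : ContDiff ℝ ∞ h
  smooth_a : ∀ μ, ContDiff ℝ ∞ (a μ)

/-- `c` solves the free field equations: Klein-Gordon for the scalar field and
the wave equation (Feynman gauge) for the photon field. -/
def Config.IsFreeSolution (m : ℝ) (c : Config) : Prop :=
  (∀ x, box c.h x + (m : ℂ) ^ 2 * c.h x = 0) ∧ ∀ μ x, box (c.a μ) x = 0

/-- Restriction `F ↦ F₀` of functionals to the space of solutions of the free field equations. -/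
def onShell {K : Type*} (m : ℝ) (F : Config → K) : {c : Config // c.IsFreeSolution m} → K :=
  fun c => F c.1

/-! ### Field polynomials and local fields -/

/-- The symbols `A^μ, φ, φ*, ∂_μ φ, ∂_μ φ*` generating the field polynomials. -/
inductive FieldVar : Type
  | A (μ : Fin 4)
  | phi
  | phiStar
  | dphi (μ : Fin 4)
  | dphiStar (μ : Fin 4)

/-- The space `𝒫` of polynomials in `A^μ, φ, φ*, ∂_μ φ, ∂_μ φ*`. -/
abbrev FieldPoly : Type := MvPolynomial FieldVar ℂ

/-- The values at the point `x` of the basic fields in the configuration `c`. -/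
def Config.jet (c : Config) (x : Mink) : FieldVar → ℂ
  | .A μ => (c.a μ x : ℂ)
  | .phi => c.h x
  | .phiStar => star (c.h x)
  | .dphi μ => pd μ c.h x
  | .dphiStar μ => pd μ (fun y => star (c.h y)) x

/-- The functional `B(g) = ∫ dx g(x) B(x)`. -/
def smear (B : FieldPoly) (g : Mink → ℂ) : Config → ℂ :=
  fun c => ∫ x, g x * MvPolynomial.eval (c.jet x) B

/-- The space of local fields: the linear span of the functionals `B(g)`, where `B` is a field
polynomial and `g` a test function. -/
def Floc : Submodule ℂ (Config → ℂ) :=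
  Submodule.span ℂ {F | ∃ (B : FieldPoly) (g : TestC), F = smear B g}


/-! ### Local fields along one-parameter families of configurations -/

lemma TestR.smooth (α : TestR) : ContDiff ℝ ∞ (α : Mink → ℝ) := α.contDiff

lemma contDiff_pd {E : Type} [NormedAddCommGroup E] [NormedSpace ℝ E] (μ : Fin 4)
    {f : Mink → E} (hf : ContDiff ℝ ∞ f) : ContDiff ℝ ∞ (pd μ f) :=
  (hf.fderiv_right (m := ∞) (by simp)).clm_apply contDiff_const

lemma hasCompactSupport_pd {E : Type} [NormedAddCommGroup E] [NormedSpace ℝ E] (μ : Fin 4)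
    {f : Mink → E} (hf : HasCompactSupport f) : HasCompactSupport (pd μ f) :=
  hf.fderiv_apply ℝ _

lemma contDiff_star {E : Type*} [NormedAddCommGroup E] [NormedSpace ℝ E] {f : E → ℂ}
    (hf : ContDiff ℝ ∞ f) : ContDiff ℝ ∞ (fun x => star (f x)) :=
  Complex.conjCLE.toContinuousLinearMap.contDiff.comp hf

lemma smear_mem (B : FieldPoly) {g : Mink → ℂ} (hg : ContDiff ℝ ∞ g) (hc : HasCompactSupport g) :
    smear B g ∈ Floc :=
  Submodule.subset_span ⟨B, ⟨g, hg, hc, fun _ _ => trivial⟩, rfl⟩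

/-- For a jointly smooth `f`, the derivative in the parameter and a spatial partial derivative
commute. -/
lemma hasDerivAt_pd {f : ℝ × Mink → ℂ} (hf : ContDiff ℝ ∞ f) (μ : Fin 4) (s : ℝ) (x : Mink)
    {f' : Mink → ℂ} (hf' : ∀ y, HasDerivAt (fun r => f (r, y)) (f' y) s) :
    HasDerivAt (fun r => pd μ (fun y => f (r, y)) x) (pd μ f' x) s := by
  have hd : ∀ p, HasFDerivAt f (fderiv ℝ f p) p := fun p =>
    ((hf.differentiable (by simp)) p).hasFDerivAt
  have hd2 : ∀ p, HasFDerivAt (fderiv ℝ f) (fderiv ℝ (fderiv ℝ f) p) p := fun p =>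
    (((hf.fderiv_right (m := ∞) (by simp)).differentiable (by simp)) p).hasFDerivAt
  have hr : ∀ (r : ℝ) (y : Mink), HasFDerivAt (fun r : ℝ => (r, y))
      (ContinuousLinearMap.inl ℝ ℝ Mink) r := fun r y => hasFDerivAt_prodMk_left r y
  have hy : ∀ (r : ℝ) (y : Mink), HasFDerivAt (fun y : Mink => (r, y))
      (ContinuousLinearMap.inr ℝ ℝ Mink) y := fun r y => hasFDerivAt_prodMk_right r y
  have h1 : ∀ r, pd μ (fun y => f (r, y)) x = fderiv ℝ f (r, x) (0, Pi.single μ 1) := by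
    intro r
    have := ((hd (r, x)).comp x (hy r x)).fderiv
    simp only [pd]
    rw [show (fun y => f (r, y)) = f ∘ (fun y => (r, y)) from rfl, this]
    simp
  have h2 : ∀ y, f' y = fderiv ℝ f (s, y) (1, 0) := by
    intro y
    have h := ((hd (s, y)).comp s (hr s y)).hasDerivAt
    have := (hf' y).unique h
    simpa using this
  have h3 : pd μ f' x = fderiv ℝ (fderiv ℝ f) (s, x) (0, Pi.single μ 1) (1, 0) := by
    have e : f' = fun y => fderiv ℝ f (s, y) (1, 0) := funext h2
    have := (((hd2 (s, x)).comp x (hy s x)).clm_apply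
      (hasFDerivAt_const ((1, 0) : ℝ × Mink) x)).fderiv
    simp only [pd]
    rw [e]
    simp only [Function.comp_def] at this
    rw [this]
    simp
  have h4 : HasDerivAt (fun r => fderiv ℝ f (r, x) (0, Pi.single μ 1))
      (fderiv ℝ (fderiv ℝ f) (s, x) (1, 0) (0, Pi.single μ 1)) s := by
    have := (((hd2 (s, x)).comp s (hr s x)).clm_apply
      (hasFDerivAt_const ((0, Pi.single μ 1) : ℝ × Mink) s)).hasDerivAt
    simpa [Function.comp_def] using this
  have hsymm : IsSymmSndFDerivAt ℝ f (s, x) :=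
    (hf.contDiffAt).isSymmSndFDerivAt (by
      rw [minSmoothness_of_isRCLikeNormedField]
      exact WithTop.coe_le_coe.2 le_top)
  rw [h3, hsymm.eq]
  simpa only [h1] using h4

/-- A smooth one-parameter family of configurations with fixed photon configuration. -/
structure IsSmoothFamily (c : ℝ → Config) : Prop where
  smooth : ContDiff ℝ ∞ (fun p : ℝ × Mink => (c p.1).h p.2)
  photon : ∀ s s' : ℝ, (c s).a = (c s').a

lemma contDiff_pd_param {f : ℝ × Mink → ℂ} (hf : ContDiff ℝ ∞ f) (μ : Fin 4) :
    ContDiff ℝ ∞ (fun p : ℝ × Mink => pd μ (fun y => f (p.1, y)) p.2) := by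
  have hd : ∀ p, HasFDerivAt f (fderiv ℝ f p) p := fun p =>
    ((hf.differentiable (by simp)) p).hasFDerivAt
  have h1 : ∀ p : ℝ × Mink, pd μ (fun y => f (p.1, y)) p.2 =
      fderiv ℝ f p (0, Pi.single μ 1) := by
    rintro ⟨r, x⟩
    have hy : HasFDerivAt (fun y : Mink => (r, y)) (ContinuousLinearMap.inr ℝ ℝ Mink) x :=
      hasFDerivAt_prodMk_right r x
    have := ((hd (r, x)).comp x hy).fderiv
    simp only [pd]
    rw [show (fun y => f (r, y)) = f ∘ (fun y => (r, y)) from rfl, this]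
    simp
  simp only [h1]
  exact (hf.fderiv_right (m := ∞) (by simp)).clm_apply contDiff_const

lemma IsSmoothFamily.jet {c : ℝ → Config} (hc : IsSmoothFamily c) (v : FieldVar) :
    ContDiff ℝ ∞ (fun p : ℝ × Mink => (c p.1).jet p.2 v) := by
  cases v with
  | A μ =>
    simp only [Config.jet, hc.photon _ 0]
    exact Complex.ofRealCLM.contDiff.comp (((c 0).smooth_a μ).comp contDiff_snd)
  | phi => exact hc.smooth
  | phiStar => exact contDiff_star hc.smooth
  | dphi μ => exact contDiff_pd_param hc.smooth μ
  | dphiStar μ => exact contDiff_pd_param (contDiff_star hc.smooth) μ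

lemma IsSmoothFamily.eval {c : ℝ → Config} (hc : IsSmoothFamily c) (B : FieldPoly) :
    ContDiff ℝ ∞ (fun p : ℝ × Mink => MvPolynomial.eval ((c p.1).jet p.2) B) := by
  induction B using MvPolynomial.induction_on with
  | C z => simpa using contDiff_const
  | add p q hp hq => simpa using hp.add hq
  | mul_X p v hp => simpa using hp.mul (hc.jet v)

lemma IsSmoothFamily.continuous_eval {c : ℝ → Config} (hc : IsSmoothFamily c) (B : FieldPoly)
    (s : ℝ) : Continuous fun x => MvPolynomial.eval ((c s).jet x) B := by
  have h1 := (hc.eval B).continuous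
  have h2 : Continuous fun x : Mink => (s, x) := by fun_prop
  have h3 := h1.comp h2
  simp only [Function.comp_def] at h3
  exact h3

/-- The charge number operator: the derivation of the algebra of field polynomials with
`φ ↦ φ`, `∂φ ↦ ∂φ`, `φ* ↦ -φ*`, `∂φ* ↦ -∂φ*`. -/
def chargeOp : Derivation ℂ FieldPoly FieldPoly :=
  MvPolynomial.mkDerivation ℂ fun
    | .A _ => 0
    | .phi => MvPolynomial.X .phi
    | .phiStar => -MvPolynomial.X .phiStar
    | .dphi μ => MvPolynomial.X (.dphi μ)
    | .dphiStar μ => -MvPolynomial.X (.dphiStar μ)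

/-- The modified charge number operator: the derivation with `∂_μ φ ↦ φ`, `∂_μ φ* ↦ -φ*`. -/
def chargeOpDir (μ : Fin 4) : Derivation ℂ FieldPoly FieldPoly :=
  MvPolynomial.mkDerivation ℂ fun
    | .dphi ν => if ν = μ then MvPolynomial.X .phi else 0
    | .dphiStar ν => if ν = μ then -MvPolynomial.X .phiStar else 0
    | _ => 0

lemma pd_mul_ofReal (μ : Fin 4) {α : Mink → ℝ} (hα : ContDiff ℝ ∞ α) {f : Mink → ℂ}
    (hf : ContDiff ℝ ∞ f) (z : ℂ) (x : Mink) :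
    pd μ (fun y => z * (α y : ℂ) * f y) x =
      z * (α x : ℂ) * pd μ f x + z * ((pd μ α x : ℝ) : ℂ) * f x := by
  have h1 : HasFDerivAt α (fderiv ℝ α x) x := ((hα.differentiable (by simp)) x).hasFDerivAt
  have h2 : HasFDerivAt f (fderiv ℝ f x) x := ((hf.differentiable (by simp)) x).hasFDerivAt
  have h3 := (((Complex.ofRealCLM.hasFDerivAt.comp x h1).const_mul z).mul h2).fderiv
  simp only [pd]
  simp only [Function.comp_def, Complex.ofRealCLM_apply] at h3
  refine (DFunLike.congr_fun h3 _).trans ?_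
  simp
  ring

lemma hasDerivAt_eval {c : ℝ → Config} (hc : IsSmoothFamily c) {α : Mink → ℝ}
    (hα : ContDiff ℝ ∞ α) (s : ℝ)
    (hd : ∀ x, HasDerivAt (fun r => (c r).h x) (Complex.I * (α x : ℂ) * (c s).h x) s)
    (B : FieldPoly) (x : Mink) :
    HasDerivAt (fun r => MvPolynomial.eval ((c r).jet x) B)
      (Complex.I * (α x : ℂ) * MvPolynomial.eval ((c s).jet x) (chargeOp B) +
        ∑ μ, Complex.I * ((pd μ α x : ℝ) : ℂ) * MvPolynomial.eval ((c s).jet x) (chargeOpDir μ B))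
      s := by
  have hds : ∀ y, HasDerivAt (fun r => star ((c r).h y))
      (-Complex.I * (α y : ℂ) * star ((c s).h y)) s := by
    intro y
    have := (hd y).star
    simpa using this
  have hjet : ∀ v, HasDerivAt (fun r => (c r).jet x v)
      (Complex.I * (α x : ℂ) * MvPolynomial.eval ((c s).jet x) (chargeOp (.X v)) +
        ∑ μ, Complex.I * ((pd μ α x : ℝ) : ℂ) *
          MvPolynomial.eval ((c s).jet x) (chargeOpDir μ (.X v))) s := by
    intro v
    cases v with
    | A μ =>
      simp only [Config.jet, hc.photon _ s, chargeOp, chargeOpDir, MvPolynomial.mkDerivation_X]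
      simpa using hasDerivAt_const s _
    | phi =>
      simp only [Config.jet, chargeOp, chargeOpDir, MvPolynomial.mkDerivation_X]
      simpa [Config.jet] using hd x
    | phiStar =>
      simp only [Config.jet, chargeOp, chargeOpDir, MvPolynomial.mkDerivation_X]
      simpa [Config.jet] using hds x
    | dphi μ =>
      simp only [Config.jet, chargeOp, chargeOpDir, MvPolynomial.mkDerivation_X]
      have := hasDerivAt_pd hc.smooth μ s x hd
      rw [pd_mul_ofReal μ hα (c s).smooth_h] at this
      simpa [Config.jet, apply_ite] using this
    | dphiStar μ =>
      simp only [Config.jet, chargeOp, chargeOpDir, MvPolynomial.mkDerivation_X]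
      have := hasDerivAt_pd (contDiff_star hc.smooth) μ s x hds
      rw [pd_mul_ofReal μ hα (contDiff_star (c s).smooth_h)] at this
      simpa [Config.jet, apply_ite] using this
  induction B using MvPolynomial.induction_on with
  | C z => simpa [MvPolynomial.derivation_C] using hasDerivAt_const s _
  | add p q hp hq =>
    have := hp.add hq
    simp only [map_add]
    refine HasDerivAt.congr_deriv this ?_
    simp only [mul_add, Finset.sum_add_distrib]
    ring
  | mul_X p v hp =>
    have := hp.mul (hjet v)
    simp only [map_mul, MvPolynomial.eval_X, Derivation.leibniz, smul_eq_mul, map_add]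
    refine HasDerivAt.congr_deriv this ?_
    simp only [add_mul, mul_add, Finset.sum_add_distrib, Finset.sum_mul, Finset.mul_sum]
    have e1 : ∀ μ, Complex.I * ((pd μ α x : ℝ) : ℂ) * (MvPolynomial.eval ((c s).jet x) p *
        MvPolynomial.eval ((c s).jet x) (chargeOpDir μ (.X v))) =
        MvPolynomial.eval ((c s).jet x) p * (Complex.I * ((pd μ α x : ℝ) : ℂ) *
        MvPolynomial.eval ((c s).jet x) (chargeOpDir μ (.X v))) := fun μ => by ring
    have e2 : ∀ μ, Complex.I * ((pd μ α x : ℝ) : ℂ) * ((c s).jet x v *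
        MvPolynomial.eval ((c s).jet x) (chargeOpDir μ p)) =
        Complex.I * ((pd μ α x : ℝ) : ℂ) *
        MvPolynomial.eval ((c s).jet x) (chargeOpDir μ p) * (c s).jet x v := fun μ => by ring
    simp only [e1, e2]
    ring

/-- Differentiation under the integral sign for smooth integrands of compact spatial support. -/
lemma hasDerivAt_integral_smooth {f : ℝ × Mink → ℂ} (hf : ContDiff ℝ ∞ f) {k : Set Mink}
    (hk : IsCompact k) (hsupp : ∀ r x, x ∉ k → f (r, x) = 0) (s : ℝ) {f' : Mink → ℂ}
    (hf' : ∀ x, HasDerivAt (fun r => f (r, x)) (f' x) s) :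
    HasDerivAt (fun r => ∫ x, f (r, x)) (∫ x, f' x) s := by
  have hd : ∀ p : ℝ × Mink, HasDerivAt (fun r => f (r, p.2)) (fderiv ℝ f p (1, 0)) p.1 := by
    rintro ⟨r, x⟩
    have h1 : HasFDerivAt f (fderiv ℝ f (r, x)) (r, x) :=
      ((hf.differentiable (by simp)) (r, x)).hasFDerivAt
    have h2 : HasFDerivAt (fun r : ℝ => (r, x)) (ContinuousLinearMap.inl ℝ ℝ Mink) r :=
      hasFDerivAt_prodMk_left r x
    have h := (h1.comp r h2).hasDerivAt
    simpa [Function.comp_def] using h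
  have hcont : Continuous (fun p : ℝ × Mink => fderiv ℝ f p (1, 0)) :=
    ((hf.fderiv_right (m := ∞) (by simp)).clm_apply contDiff_const).continuous
  have hzero : ∀ r x, x ∉ k → fderiv ℝ f (r, x) (1, 0) = 0 := by
    intro r x hx
    have h1 := hd (r, x)
    have h2 : (fun r => f (r, x)) = fun _ => 0 := funext fun r => hsupp r x hx
    simp only [h2] at h1
    exact h1.unique (hasDerivAt_const r 0)
  have e : f' = fun x => fderiv ℝ f (s, x) (1, 0) := funext fun x => (hf' x).unique (hd (s, x))
  obtain ⟨C, hC⟩ := ((isCompact_closedBall s 1).prod hk).exists_bound_of_continuousOn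
    hcont.continuousOn
  have hint : ∀ r, HasCompactSupport (fun x => f (r, x)) := fun r =>
    HasCompactSupport.intro hk (fun x hx => hsupp r x hx)
  have hfc : ∀ r, Continuous (fun x => f (r, x)) := fun r =>
    hf.continuous.comp (by fun_prop)
  rw [e]
  refine (hasDerivAt_integral_of_dominated_loc_of_deriv_le
    (F := fun r x => f (r, x)) (F' := fun r x => fderiv ℝ f (r, x) (1, 0))
    (bound := k.indicator fun _ => C) (Metric.closedBall_mem_nhds s one_pos) ?_ ?_ ?_ ?_ ?_ ?_).2
  · exact Filter.Eventually.of_forall fun r => (hfc r).aestronglyMeasurable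
  · exact (hfc s).integrable_of_hasCompactSupport (hint s)
  · exact (hcont.comp (by fun_prop : Continuous fun x : Mink => (s, x))).aestronglyMeasurable
  · refine Filter.Eventually.of_forall fun x r hr => ?_
    by_cases hx : x ∈ k
    · simpa [Set.indicator_of_mem hx] using hC (r, x) ⟨hr, hx⟩
    · simp [Set.indicator_of_notMem hx, hzero r x hx]
  · exact (MeasureTheory.integrable_indicator_iff hk.measurableSet).2
      (MeasureTheory.integrableOn_const hk.measure_lt_top.ne)
  · exact Filter.Eventually.of_forall fun x r _ => hd (r, x)


/-- Along smooth families of configurations whose velocity is the infinitesimal local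
`U(1)`-transformation `φ ↦ iαφ`, a local field is differentiable, and its derivative is again a
local field. -/
lemma exists_local_derivative (α : TestR) {F : Config → ℂ} (hF : F ∈ Floc) :
    ∃ F' ∈ Floc, ∀ (c : ℝ → Config) (s : ℝ), IsSmoothFamily c →
      (∀ x, HasDerivAt (fun r => (c r).h x) (Complex.I * (α x : ℂ) * (c s).h x) s) →
      HasDerivAt (fun r => F (c r)) (F' (c s)) s := by
  induction hF using Submodule.span_induction with
  | zero =>
    exact ⟨0, Submodule.zero_mem _, fun c s _ _ => hasDerivAt_const s (0 : ℂ)⟩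
  | add F G _ _ hF hG =>
    obtain ⟨F', hF', h1⟩ := hF
    obtain ⟨G', hG', h2⟩ := hG
    exact ⟨F' + G', Submodule.add_mem _ hF' hG', fun c s hc hd =>
      (h1 c s hc hd).add (h2 c s hc hd)⟩
  | smul z F _ hF =>
    obtain ⟨F', hF', h1⟩ := hF
    exact ⟨z • F', Submodule.smul_mem _ z hF', fun c s hc hd => (h1 c s hc hd).const_mul z⟩
  | mem F hF =>
    obtain ⟨B, g, rfl⟩ := hF
    have hg : ContDiff ℝ ∞ (g : Mink → ℂ) := g.contDiff
    have hα : ContDiff ℝ ∞ (α : Mink → ℝ) := α.contDiff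
    have hpd : ∀ μ, ContDiff ℝ ∞ (fun x => ((pd μ α x : ℝ) : ℂ)) := fun μ =>
      Complex.ofRealCLM.contDiff.comp (contDiff_pd μ hα)
    have hαc : ContDiff ℝ ∞ (fun x => ((α x : ℝ) : ℂ)) := Complex.ofRealCLM.contDiff.comp hα
    have s0 : ContDiff ℝ ∞ (fun x => g x * (Complex.I * (α x : ℂ))) :=
      hg.mul (contDiff_const.mul hαc)
    have s1 : ∀ μ, ContDiff ℝ ∞ (fun x => g x * (Complex.I * ((pd μ α x : ℝ) : ℂ))) := fun μ =>
      hg.mul (contDiff_const.mul (hpd μ))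
    have k0 : HasCompactSupport (fun x => g x * (Complex.I * (α x : ℂ))) :=
      g.hasCompactSupport.mul_right
    have k1 : ∀ μ, HasCompactSupport (fun x => g x * (Complex.I * ((pd μ α x : ℝ) : ℂ))) :=
      fun μ => g.hasCompactSupport.mul_right
    refine ⟨smear (chargeOp B) (fun x => g x * (Complex.I * (α x : ℂ))) +
      ∑ μ, smear (chargeOpDir μ B) (fun x => g x * (Complex.I * ((pd μ α x : ℝ) : ℂ))),
      Submodule.add_mem _ (smear_mem _ s0 k0)
        (Submodule.sum_mem _ fun μ _ => smear_mem _ (s1 μ) (k1 μ)), fun c s hc hd => ?_⟩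
    have hev := fun P => hc.continuous_eval P s
    have hder : ∀ x, HasDerivAt (fun r => g x * MvPolynomial.eval ((c r).jet x) B)
        (g x * (Complex.I * (α x : ℂ) * MvPolynomial.eval ((c s).jet x) (chargeOp B) +
          ∑ μ, Complex.I * ((pd μ α x : ℝ) : ℂ) *
            MvPolynomial.eval ((c s).jet x) (chargeOpDir μ B))) s :=
      fun x => (hasDerivAt_eval hc hα s hd B x).const_mul (g x)
    have hsm : ContDiff ℝ ∞
        (fun p : ℝ × Mink => g p.2 * MvPolynomial.eval ((c p.1).jet p.2) B) :=
      (hg.comp contDiff_snd).mul (hc.eval B)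
    have hz : ∀ (r : ℝ) (x : Mink), x ∉ tsupport g →
        g x * MvPolynomial.eval ((c r).jet x) B = 0 := by
      intro r x hx
      rw [image_eq_zero_of_notMem_tsupport hx, zero_mul]
    have key := hasDerivAt_integral_smooth hsm (k := tsupport g) g.hasCompactSupport hz s hder
    have e : (smear (chargeOp B) (fun x => g x * (Complex.I * (α x : ℂ))) +
        ∑ μ, smear (chargeOpDir μ B) (fun x => g x * (Complex.I * ((pd μ α x : ℝ) : ℂ)))) (c s) =
        ∫ x, g x * (Complex.I * (α x : ℂ) * MvPolynomial.eval ((c s).jet x) (chargeOp B) +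
          ∑ μ, Complex.I * ((pd μ α x : ℝ) : ℂ) *
            MvPolynomial.eval ((c s).jet x) (chargeOpDir μ B)) := by
      simp only [Pi.add_apply, Finset.sum_apply, smear]
      rw [← MeasureTheory.integral_finsetSum, ← MeasureTheory.integral_add]
      · congr 1
        funext x
        simp only [mul_add, Finset.mul_sum]
        simp only [mul_assoc]
      · exact (s0.continuous.mul (hev _)).integrable_of_hasCompactSupport k0.mul_right
      · exact MeasureTheory.integrable_finsetSum _ fun μ _ =>
          ((s1 μ).continuous.mul (hev _)).integrable_of_hasCompactSupport (k1 μ).mul_right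
      · exact fun μ _ =>
          ((s1 μ).continuous.mul (hev _)).integrable_of_hasCompactSupport (k1 μ).mul_right
    rw [e]
    exact key

/-! ### The local `U(1)`-transformation -/

/-- The configuration `(e^{iα} h, a)`. -/
def Config.rotate (α : TestR) (c : Config) : Config where
  h := fun x => Complex.exp (Complex.I * (α x : ℂ)) * c.h x
  a := c.a
  smooth_h := ((contDiff_const.mul
    (Complex.ofRealCLM.contDiff.comp (TestR.smooth α))).cexp).mul c.smooth_h
  smooth_a := c.smooth_a

/-- The configuration `(h + s αQ, a)` with `Q = -i h`, for a real parameter `s`. -/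
def Config.shiftQ (α : TestR) (s : ℝ) (c : Config) : Config where
  h := fun x => c.h x + (s : ℂ) * ((α x : ℂ) * (-Complex.I * c.h x))
  a := c.a
  smooth_h := c.smooth_h.add (contDiff_const.mul
    ((Complex.ofRealCLM.contDiff.comp (TestR.smooth α)).mul (contDiff_const.mul c.smooth_h)))
  smooth_a := c.smooth_a

/-- The functional `F_α := F(φ e^{iα}, φ* e^{-iα}, A)`. -/
def transform (α : TestR) (F : Config → ℂ) : Config → ℂ := fun c => F (c.rotate α)

/-- The coefficient of `t^k` in the Taylor expansion of `f(t)` at `t = 0`. -/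
def taylorCoeff (k : ℕ) (f : ℝ → ℂ) : ℂ := iteratedDeriv k f 0 / (k ! : ℂ)

lemma rotate_family (α : TestR) (c : Config) : IsSmoothFamily fun t => c.rotate (t • α) where
  smooth := by
    have hα : ContDiff ℝ ∞ (fun p : ℝ × Mink => α p.2) := (TestR.smooth α).comp contDiff_snd
    have h1 : ContDiff ℝ ∞ (fun p : ℝ × Mink => (((p.1 * α p.2 : ℝ)) : ℂ)) :=
      Complex.ofRealCLM.contDiff.comp (contDiff_fst.mul hα)
    exact ((contDiff_const.mul h1).cexp).mul (c.smooth_h.comp contDiff_snd)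
  photon := fun _ _ => rfl

lemma shiftQ_family (α : TestR) (c : Config) : IsSmoothFamily fun s => c.shiftQ α (-s) where
  smooth := by
    have hα : ContDiff ℝ ∞ (fun p : ℝ × Mink => ((α p.2 : ℝ) : ℂ)) :=
      Complex.ofRealCLM.contDiff.comp ((TestR.smooth α).comp contDiff_snd)
    have h1 : ContDiff ℝ ∞ (fun p : ℝ × Mink => (((-p.1 : ℝ)) : ℂ)) :=
      Complex.ofRealCLM.contDiff.comp contDiff_fst.neg
    have h2 : ContDiff ℝ ∞ (fun p : ℝ × Mink => c.h p.2) := c.smooth_h.comp contDiff_snd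
    exact h2.add (h1.mul (hα.mul (contDiff_const.mul h2)))
  photon := fun _ _ => rfl

lemma hasDerivAt_rotate (α : TestR) (c : Config) (t : ℝ) (x : Mink) :
    HasDerivAt (fun r : ℝ => (c.rotate (r • α)).h x)
      (Complex.I * (α x : ℂ) * (c.rotate (t • α)).h x) t := by
  have h1 : HasDerivAt (fun r : ℝ => Complex.I * (((r * α x : ℝ)) : ℂ))
      (Complex.I * (((1 * α x : ℝ)) : ℂ)) t :=
    (((hasDerivAt_id t).mul_const (α x)).ofReal_comp).const_mul _
  have h2 := (h1.cexp).mul_const (c.h x)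
  refine HasDerivAt.congr_deriv h2 ?_
  change _ = _ * (Complex.exp (Complex.I * ((t * α x : ℝ) : ℂ)) * _)
  rw [one_mul]
  ring

lemma hasDerivAt_shiftQ (α : TestR) (c : Config) (x : Mink) :
    HasDerivAt (fun r : ℝ => (c.shiftQ α (-r)).h x)
      (Complex.I * (α x : ℂ) * (c.shiftQ α (-(0 : ℝ))).h x) 0 := by
  have h1 : HasDerivAt (fun r : ℝ => (((-r : ℝ)) : ℂ)) (((-1 : ℝ)) : ℂ) 0 :=
    ((hasDerivAt_id (0 : ℝ)).neg).ofReal_comp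
  have h2 := (h1.mul_const ((α x : ℂ) * (-Complex.I * c.h x))).const_add (c.h x)
  refine HasDerivAt.congr_deriv h2 ?_
  simp [Config.shiftQ]
  ring

lemma shiftQ_zero (α : TestR) (c : Config) : c.shiftQ α 0 = c := by
  ext <;> simp [Config.shiftQ]

lemma rotate_zero (c : Config) : c.rotate 0 = c := by
  ext <;> simp [Config.rotate]

lemma exists_iterated_derivative (α : TestR) {F : Config → ℂ} (hF : F ∈ Floc) (k : ℕ) :
    ∃ G ∈ Floc, ∀ c, iteratedDeriv k (fun t : ℝ => transform (t • α) F c) =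
      fun t : ℝ => transform (t • α) G c := by
  induction k with
  | zero => exact ⟨F, hF, fun c => by simp⟩
  | succ k ih =>
    obtain ⟨G, hG, h⟩ := ih
    obtain ⟨G', hG', h'⟩ := exists_local_derivative α hG
    refine ⟨G', hG', fun c => ?_⟩
    rw [iteratedDeriv_succ, h c]
    funext t
    exact (h' _ t (rotate_family α c) (hasDerivAt_rotate α c t)).deriv

lemma taylorCoeff_transform_mem (α : TestR) (F : Floc) (k : ℕ) :
    (fun c => taylorCoeff k fun t => transform (t • α) F.1 c) ∈ Floc := by
  obtain ⟨G, hG, h⟩ := exists_iterated_derivative α F.2 k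
  have e : (fun c => taylorCoeff k fun t => transform (t • α) F.1 c) =
      ((k ! : ℂ)⁻¹) • G := by
    funext c
    have h0 : iteratedDeriv k (fun t : ℝ => transform (t • α) F.1 c) 0 = G c := by
      rw [h c]
      simp only [transform, zero_smul, rotate_zero]
    rw [taylorCoeff, h0, div_eq_inv_mul, Pi.smul_apply, smul_eq_mul]
  rw [e]
  exact Submodule.smul_mem _ _ hG

/-- The local field which is the term of order `k` in `α` of `F_α`. -/
def transformTerm (F : Floc) (α : TestR) (k : ℕ) : Floc :=
  ⟨fun c => taylorCoeff k fun t => transform (t • α) F.1 c, taylorCoeff_transform_mem α F k⟩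

lemma variation_mem (α : TestR) (F : Floc) :
    (fun c : Config => deriv (fun s : ℝ => F.1 (c.shiftQ α s)) 0) ∈ Floc := by
  obtain ⟨G, hG, h⟩ := exists_local_derivative α F.2
  have e : (fun c : Config => deriv (fun s : ℝ => F.1 (c.shiftQ α s)) 0) = (-1 : ℂ) • G := by
    funext c
    have h1 := h _ 0 (shiftQ_family α c) (hasDerivAt_shiftQ α c)
    simp only [neg_zero, shiftQ_zero] at h1
    have h2 := (HasDerivAt.scomp (0 : ℝ) (h := fun s : ℝ => -s) (g₁ := fun r => F.1 (c.shiftQ α (-r)))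
      (by simpa using h1) (hasDerivAt_neg (0 : ℝ))).deriv
    simpa [Function.comp_def] using h2
  rw [e]
  exact Submodule.smul_mem _ _ hG

/-- The variation `δ_{αQ} F = ∫ dy α(y) (Q(y) δF/δφ(y) + Q*(y) δF/δφ*(y))` with `Q = -iφ`, that is,
the derivative of `F` in the direction in which `φ` varies by `αQ` (and hence `φ*` by `αQ*`). -/
def variation (α : TestR) (F : Floc) : Floc :=
  ⟨fun c => deriv (fun s : ℝ => F.1 (c.shiftQ α s)) 0, variation_mem α F⟩

/-! ### The current and the free Lagrangian -/

/-- The current component with lower index, `j_μ = i (φ ∂_μ φ* - φ* ∂_μ φ)`. -/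
def current (μ : Fin 4) : FieldPoly :=
  MvPolynomial.C Complex.I *
    (MvPolynomial.X .phi * MvPolynomial.X (.dphiStar μ) -
      MvPolynomial.X .phiStar * MvPolynomial.X (.dphi μ))

/-- The divergence of the current as a distribution, `(∂j)(α) = -∫ dx j^μ(x) ∂_μ α(x)`. -/
def divCurrent (α : TestR) : Floc :=
  ⟨-∑ μ, smear (current μ) (fun x => ((metric μ * pd μ α x : ℝ) : ℂ)),
    Submodule.neg_mem _ (Submodule.sum_mem _ fun μ _ => smear_mem _
      (Complex.ofRealCLM.contDiff.comp (contDiff_const.mul (contDiff_pd μ (TestR.smooth α))))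
      (((hasCompactSupport_pd μ α.hasCompactSupport).mul_left).comp_left Complex.ofReal_zero))⟩

/-- The field strength `F_{μν} = ∂_μ A_ν - ∂_ν A_μ` (with `A_μ = g_{μμ} A^μ`). -/
def fieldStrength (μ ν : Fin 4) (c : Config) (x : Mink) : ℝ :=
  metric ν * pd μ (c.a ν) x - metric μ * pd ν (c.a μ) x

/-- The free Lagrangian `L₀(x) = ∂_μ φ* ∂^μ φ - m² φ* φ - ¼ F^{μν} F_{μν}`. -/
def freeLagrangian (m : ℝ) (x : Mink) : Config → ℂ := fun c =>
  (∑ μ, (metric μ : ℂ) * (pd μ (fun y => star (c.h y)) x * pd μ c.h x))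
    - (m : ℂ) ^ 2 * (star (c.h x) * c.h x)
    - (1 / 4 : ℂ) * ∑ μ, ∑ ν,
      (metric μ : ℂ) * (metric ν : ℂ) * (fieldStrength μ ν c x : ℂ) ^ 2

/-- `δL₀(α) = ∫ dx (L₀(x)_α - L₀(x))`. -/
def deltaL (m : ℝ) (α : TestR) : Config → ℂ := fun c =>
  ∫ x, (transform α (freeLagrangian m x) c - freeLagrangian m x c)

lemma quadratic_mem (α : TestR) :
    smear (MvPolynomial.X .phiStar * MvPolynomial.X .phi)
      (fun x => ((∑ μ, metric μ * (pd μ α x * pd μ α x) : ℝ) : ℂ)) ∈ Floc := by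
  have h1 : ∀ μ, ContDiff ℝ ∞ (pd μ α) := fun μ => contDiff_pd μ (TestR.smooth α)
  have h0 : ContDiff ℝ ∞ (fun x => ∑ μ, metric μ * (pd μ α x * pd μ α x)) :=
    ContDiff.sum fun μ _ => contDiff_const.mul ((h1 μ).mul (h1 μ))
  refine smear_mem _ (Complex.ofRealCLM.contDiff.comp h0) ?_
  refine HasCompactSupport.intro (K := tsupport α) α.hasCompactSupport fun x hx => ?_
  have h2 : ∀ μ, pd μ α x = 0 := by
    intro μ
    have : fderiv ℝ α x = 0 := by
      by_contra hne
      exact hx (support_fderiv_subset ℝ (Function.mem_support.2 hne))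
    simp [pd, this]
  simp [h2]

lemma pd_rotate (α : TestR) (c : Config) (μ : Fin 4) (x : Mink) :
    pd μ (c.rotate α).h x = Complex.exp (Complex.I * (α x : ℂ)) *
      (pd μ c.h x + Complex.I * ((pd μ α x : ℝ) : ℂ) * c.h x) := by
  have h1 : HasFDerivAt α (fderiv ℝ α x) x :=
    (((TestR.smooth α).differentiable (by simp)) x).hasFDerivAt
  have h2 : HasFDerivAt c.h (fderiv ℝ c.h x) x :=
    ((c.smooth_h.differentiable (by simp)) x).hasFDerivAt
  have h3 := ((((Complex.ofRealCLM.hasFDerivAt.comp x h1).const_mul Complex.I).cexp).mul h2).fderiv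
  simp only [Function.comp_def, Complex.ofRealCLM_apply] at h3
  refine (DFunLike.congr_fun h3 _).trans ?_
  simp [pd]
  ring

lemma pd_star (μ : Fin 4) (f : Mink → ℂ) (x : Mink) :
    pd μ (fun y => star (f y)) x = star (pd μ f x) := by
  by_cases hf : DifferentiableAt ℝ f x
  · have h := (Complex.conjCLE.toContinuousLinearMap.hasFDerivAt.comp x hf.hasFDerivAt).fderiv
    exact DFunLike.congr_fun h _
  · have h2 : ¬ DifferentiableAt ℝ (fun y => star (f y)) x := by
      intro h
      apply hf
      have h4 := Complex.conjCLE.toContinuousLinearMap.differentiableAt.comp x h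
      simpa [Function.comp_def] using h4
    rw [pd, pd, fderiv_zero_of_not_differentiableAt hf, fderiv_zero_of_not_differentiableAt h2]
    simp

lemma lagrangian_difference (m : ℝ) (α : TestR) (c : Config) (x : Mink) :
    transform α (freeLagrangian m x) c - freeLagrangian m x c =
      (∑ μ, ((metric μ * pd μ α x : ℝ) : ℂ) * MvPolynomial.eval (c.jet x) (current μ)) +
        ((∑ μ, metric μ * (pd μ α x * pd μ α x) : ℝ) : ℂ) *
          MvPolynomial.eval (c.jet x) (MvPolynomial.X .phiStar * MvPolynomial.X .phi) := by
  have hE : star (Complex.exp (Complex.I * (α x : ℂ))) * Complex.exp (Complex.I * (α x : ℂ)) = 1 := by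
    rw [Complex.star_def, ← Complex.exp_conj, ← Complex.exp_add]
    simp
  have key : ∀ μ, pd μ (fun y => star ((c.rotate α).h y)) x * pd μ (c.rotate α).h x =
      pd μ (fun y => star (c.h y)) x * pd μ c.h x +
      ((pd μ α x : ℝ) : ℂ) * MvPolynomial.eval (c.jet x) (current μ) +
      ((pd μ α x : ℝ) : ℂ) * ((pd μ α x : ℝ) : ℂ) * (star (c.h x) * c.h x) := by
    intro μ
    simp only [pd_star, pd_rotate, current, map_mul, map_sub, MvPolynomial.eval_C,
      MvPolynomial.eval_X, Config.jet, star_mul', star_add]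
    have hI : star Complex.I = -Complex.I := Complex.conj_I
    have hr : star ((pd μ α x : ℝ) : ℂ) = ((pd μ α x : ℝ) : ℂ) := Complex.conj_ofReal _
    rw [hI, hr]
    have hI2 : Complex.I * Complex.I = -1 := Complex.I_mul_I
    linear_combination ((star (pd μ c.h x) + -Complex.I * ((pd μ α x : ℝ) : ℂ) * star (c.h x)) *
      (pd μ c.h x + Complex.I * ((pd μ α x : ℝ) : ℂ) * c.h x)) * hE -
      ((pd μ α x : ℝ) : ℂ) * ((pd μ α x : ℝ) : ℂ) * (star (c.h x) * c.h x) * hI2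
  have hmass : star ((c.rotate α).h x) * (c.rotate α).h x = star (c.h x) * c.h x := by
    simp only [Config.rotate, star_mul']
    linear_combination (star (c.h x) * c.h x) * hE
  have hF : ∀ μ ν, fieldStrength μ ν (c.rotate α) x = fieldStrength μ ν c x := fun _ _ => rfl
  simp only [transform, freeLagrangian, key, hmass, hF, map_mul, MvPolynomial.eval_X, Config.jet]
  push_cast
  simp only [mul_add, Finset.sum_add_distrib, Finset.sum_mul]
  simp only [mul_assoc]
  ring

lemma deltaL_eq (m : ℝ) (α : TestR) (c : Config) :
    deltaL m α c = -(divCurrent α).1 c +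
      smear (MvPolynomial.X .phiStar * MvPolynomial.X .phi)
        (fun x => ((∑ μ, metric μ * (pd μ α x * pd μ α x) : ℝ) : ℂ)) c := by
  have hfam : IsSmoothFamily fun _ => c :=
    ⟨c.smooth_h.comp contDiff_snd, fun _ _ => rfl⟩
  have hpd : ∀ μ, ContDiff ℝ ∞ (pd μ α) := fun μ => contDiff_pd μ (TestR.smooth α)
  have c1 : ∀ μ, Continuous fun x =>
      ((metric μ * pd μ α x : ℝ) : ℂ) * MvPolynomial.eval (c.jet x) (current μ) := fun μ =>
    (Complex.continuous_ofReal.comp (continuous_const.mul (hpd μ).continuous)).mul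
      (hfam.continuous_eval _ 0)
  have c2 : Continuous fun x => ((∑ μ, metric μ * (pd μ α x * pd μ α x) : ℝ) : ℂ) *
      MvPolynomial.eval (c.jet x) (MvPolynomial.X .phiStar * MvPolynomial.X .phi) :=
    (Complex.continuous_ofReal.comp (continuous_finsetSum _ fun μ _ =>
      continuous_const.mul ((hpd μ).continuous.mul (hpd μ).continuous))).mul
      (hfam.continuous_eval _ 0)
  have hz : ∀ x, x ∉ tsupport α → ∀ μ, pd μ α x = 0 := by
    intro x hx μ
    have : fderiv ℝ α x = 0 := by
      by_contra hne
      exact hx (support_fderiv_subset ℝ (Function.mem_support.2 hne))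
    simp [pd, this]
  have i1 : ∀ μ ∈ Finset.univ, MeasureTheory.Integrable (fun x =>
      ((metric μ * pd μ α x : ℝ) : ℂ) * MvPolynomial.eval (c.jet x) (current μ)) := fun μ _ =>
    (c1 μ).integrable_of_hasCompactSupport
      (HasCompactSupport.intro (K := tsupport α) α.hasCompactSupport
        fun x hx => by simp [hz x hx])
  have i2 := c2.integrable_of_hasCompactSupport (μ := MeasureTheory.volume)
      (HasCompactSupport.intro (K := tsupport α) α.hasCompactSupport
        fun x hx => by simp [hz x hx])
  simp only [deltaL, lagrangian_difference]
  rw [MeasureTheory.integral_add (MeasureTheory.integrable_finsetSum _ i1) i2,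
    MeasureTheory.integral_finsetSum _ i1]
  simp [divCurrent, smear]

lemma pd_smul (t : ℝ) (α : TestR) (μ : Fin 4) (x : Mink) :
    pd μ (t • α : TestR) x = t * pd μ α x := by
  have h1 : DifferentiableAt ℝ α x := ((TestR.smooth α).differentiable (by simp)) x
  change fderiv ℝ (fun y => t • α y) x _ = _
  rw [fderiv_fun_const_smul h1]
  simp [pd]

lemma deltaL_smul (m : ℝ) (t : ℝ) (α : TestR) (c : Config) :
    deltaL m (t • α) c = (t : ℂ) * -(divCurrent α).1 c + (t : ℂ) ^ 2 *
      smear (MvPolynomial.X .phiStar * MvPolynomial.X .phi)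
        (fun x => ((∑ μ, metric μ * (pd μ α x * pd μ α x) : ℝ) : ℂ)) c := by
  rw [deltaL_eq]
  congr 1
  · simp only [divCurrent, Pi.neg_apply, Finset.sum_apply, smear, neg_neg, Finset.mul_sum, pd_smul]
    refine Finset.sum_congr rfl fun μ _ => ?_
    rw [← MeasureTheory.integral_const_mul]
    congr 1
    funext x
    push_cast
    ring
  · simp only [smear, pd_smul]
    rw [← MeasureTheory.integral_const_mul]
    congr 1
    funext x
    push_cast
    simp only [Finset.sum_mul, Finset.mul_sum]
    refine Finset.sum_congr rfl fun μ _ => ?_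
    ring

lemma taylorCoeff_deltaL_mem (m : ℝ) (α : TestR) (k : ℕ) :
    (fun c => taylorCoeff k fun t => deltaL m (t • α) c) ∈ Floc := by
  have key : ∀ k : ℕ, ∃ P ∈ Floc, ∃ Q ∈ Floc, ∃ R ∈ Floc, ∀ c,
      iteratedDeriv k (fun t : ℝ => deltaL m (t • α) c) =
        fun t : ℝ => P c + (t : ℂ) * Q c + (t : ℂ) ^ 2 * R c := by
    intro k
    induction k with
    | zero =>
      refine ⟨0, Submodule.zero_mem _, -(divCurrent α).1,
        Submodule.neg_mem _ (divCurrent α).2, _, quadratic_mem α, fun c => ?_⟩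
      funext t
      rw [iteratedDeriv_zero, deltaL_smul]
      simp
    | succ k ih =>
      obtain ⟨P, hP, Q, hQ, R, hR, h⟩ := ih
      refine ⟨Q, hQ, (2 : ℂ) • R, Submodule.smul_mem _ _ hR, 0, Submodule.zero_mem _,
        fun c => ?_⟩
      rw [iteratedDeriv_succ, h c]
      funext t
      have h1 : HasDerivAt (fun t : ℝ => (t : ℂ)) 1 t := (hasDerivAt_id t).ofReal_comp
      have h2 := (((hasDerivAt_const t (P c)).add (h1.mul_const (Q c))).add
        ((h1.pow 2).mul_const (R c))).deriv
      refine Eq.trans h2 ?_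
      simp
      ring
  obtain ⟨P, hP, Q, hQ, R, hR, h⟩ := key k
  have e : (fun c => taylorCoeff k fun t => deltaL m (t • α) c) = ((k ! : ℂ)⁻¹) • P := by
    funext c
    rw [taylorCoeff, h c, Pi.smul_apply, smul_eq_mul, div_eq_inv_mul]
    simp
  rw [e]
  exact Submodule.smul_mem _ _ hP

/-- The local field which is the term of order `k` in `α` of `δL₀(α)`. -/
def deltaLTerm (m : ℝ) (α : TestR) (k : ℕ) : Floc :=
  ⟨fun c => taylorCoeff k fun t => deltaL m (t • α) c, taylorCoeff_deltaL_mem m α k⟩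

/-! ### Time-ordered products and the two identities -/

/-- A sequence of symmetric multilinear maps `T_n` (`n ≥ 1`) from local fields to functionals on
the configuration space, with `T_1(F) = F`. The functionals take values in a field `K ⊇ ℂ` which
contains the value of `ħ`. Every time-ordered product which satisfies the Action Ward Identity is
such a sequence; causality and the other renormalization conditions are not required.
The map `T 0` is not used. -/
structure TProduct (K : Type*) [Field K] [Algebra ℂ K] where
  T : (n : ℕ) → MultilinearMap ℂ (fun _ : Fin n => Floc) (Config → K)
  symm : ∀ (n : ℕ) (σ : Equiv.Perm (Fin n)) (F : Fin n → Floc), T n (F ∘ σ) = T n F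
  initial : ∀ F : Floc, T 1 (fun _ => F) = fun c => algebraMap ℂ K (F.1 c)

/-- Formal power series in two parameters `λ` (index `0`, counting the order in `F`) and `t`
(index `1`, counting the order in `α`) with local fields as coefficients. -/
abbrev LocalSeries : Type := (Fin 2 →₀ ℕ) → Floc

section

variable {K : Type*} [Field K] [Algebra ℂ K]

/-- The prefactor `(i/ħ)^n / n!`. -/
def prefactor (ħ : K) (n : ℕ) : K := (algebraMap ℂ K Complex.I / ħ) ^ n / (n ! : K)

/-- The S-matrix `S(G) = 1 + ∑_{n ≥ 1} (i/ħ)^n / n! T_n(G^{⊗n})` of a formal power series `G` with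
vanishing constant term. Its coefficient at the multi-index `d` is a finite sum, since the terms
with `n > |d|` do not contribute. -/
def TProduct.S (T : TProduct K) (ħ : K) (G : LocalSeries) : MvPowerSeries (Fin 2) (Config → K) :=
  fun d => (if d = 0 then 1 else 0) +
    ∑ n ∈ Finset.Icc 1 d.degree, prefactor ħ n •
      ∑ p ∈ Finset.piAntidiag (Finset.univ : Finset (Fin n)) d, T.T n fun j => G (p j)

/-- The formal power series `λ F`, representing `F`. -/
def fieldSeries (F : Floc) : LocalSeries :=
  fun d => if d 0 = 1 ∧ d 1 = 0 then F else 0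

/-- The formal power series `λ F_{tα} + δL₀(tα)`, representing `F_α + δL₀(α)`. -/
def transformedSeries (m : ℝ) (F : Floc) (α : TestR) : LocalSeries :=
  fun d => if d 0 = 0 then deltaLTerm m α (d 1)
    else if d 0 = 1 then transformTerm F α (d 1) else 0

/-- The unitary Master Ward Identity `S(F_α + δL₀(α))₀ = S(F)₀` for all local `F` and all real test
functions `α`, as an identity of formal power series in `F` and `α`. -/
def UnitaryMWI (m : ℝ) (ħ : K) (T : TProduct K) : Prop :=
  ∀ (F : Floc) (α : TestR) (d : Fin 2 →₀ ℕ),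
    onShell m (MvPowerSeries.coeff d (T.S ħ (transformedSeries m F α))) =
      onShell m (MvPowerSeries.coeff d (T.S ħ (fieldSeries F)))

/-- `T(G ⊗ e^{iF/ħ}) = ∑_n (i/ħ)^n / n! T_{n+1}(G ⊗ F^{⊗n})` as a formal power series in `F`: the
parameter `X` counts the order in `F`. -/
def TProduct.insertion (T : TProduct K) (ħ : K) (G F : Floc) : PowerSeries (Config → K) :=
  PowerSeries.mk fun n => prefactor ħ n • T.T (n + 1) (Fin.cons G fun _ : Fin n => F)

/-- The on-shell Master Ward Identity `T((∂j)(α) ⊗ e^{iF/ħ})₀ = -T(δ_{αQ}F ⊗ e^{iF/ħ})₀` for all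
local `F` and all real test functions `α`, as an identity of formal power series in `F`. On the
right-hand side the inserted `δ_{αQ}F` is itself of first order in `F`. -/
def OnShellMWI (m : ℝ) (ħ : K) (T : TProduct K) : Prop :=
  ∀ (F : Floc) (α : TestR) (n : ℕ),
    onShell m (PowerSeries.coeff n (T.insertion ħ (divCurrent α) F)) =
      onShell m (PowerSeries.coeff n (-(PowerSeries.X * T.insertion ħ (variation α F) F)))

end

end ScalarQED

end

/-! The unitary identity is the integrated form of the on-shell one along the flow `t ↦ tα`. Write
`D = -δ_{αQ}` (`localDeriv`), `J = (∂j)(α)` and `R = ∫ ∂_μα ∂^μα φ*φ`. Rotations by `tα` form a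
one-parameter group with generator `D`, so the derivative of `F_{tα}` is `D F_{tα}`. Moreover
`δL₀(tα) = -tJ + t²R` with `D J = -2R` and `D R = 0`. Hence `G(t) = λF_{tα} + δL₀(tα)` solves the
affine equation `∂_t G = D G - J` (`smul_transformedSeries_add_single`).

Differentiating the S-matrix by the Leibniz rule (`smul_coeff_succ`) gives `∂_t S(G) = ∑_n
(i/ħ)^n/n! · defect_n(G, …, G)`, where `defect_n` is the sum over the slots of `T_n` of the
insertion of `D`, minus `(i/ħ) T_{n+1}(J, …)`. This is symmetric and multilinear, and the on-shell
identity at order `λ^n` says exactly that `defect_n(F, …, F)` vanishes on shell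
(`onShellMWI_iff_defect`).

From the on-shell identity to the unitary one: the coefficients of `defect_n(G, …, G)` involve
tuples of different local fields, so the diagonal statement is first polarized
(`MultilinearMap.eq_zero_of_diagonal`). Then every coefficient of `∂_t S(G)` vanishes on shell, and
only the order `t⁰` remains, which is `S(λF)`. Conversely, the coefficient of `λ^n t` in `S(G)` is a
nonzero multiple of `defect_n(F, …, F)`, whereas `S(λF)` has no such term.

All of this is carried out on coefficients; neither causality nor any analytic property of `T`
enters. -/

/-! ### Polarization -/

section Polarization

variable {V W : Type*} [AddCommGroup V] [Module ℂ V] [AddCommGroup W] [Module ℂ W]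

/-- The alternating sum over the subsets containing the range of a non-surjective map vanishes. -/
lemma sum_neg_one_pow_card_mul_prod_ite_eq_zero {ι : Type*} [Fintype ι] [DecidableEq ι]
    {r : ι → ι} (hr : ¬ Function.Surjective r) :
    ∑ s : Finset ι, (-1 : ℂ) ^ s.card * ∏ j, (if r j ∈ s then (1 : ℂ) else 0) = 0 := by
  obtain ⟨i, hi⟩ := not_forall.1 hr
  have hi' : ∀ j, r j ≠ i := fun j h => hi ⟨j, h⟩
  -- Toggling the missed value `i` in `s` flips the sign and changes no factor of the product.
  refine Finset.sum_involution (fun s _ => if i ∈ s then s.erase i else insert i s) ?_ ?_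
    (fun _ _ => Finset.mem_univ _) ?_
  · intro s _
    by_cases h : i ∈ s
    · rw [if_pos h, ← Finset.card_erase_add_one h]
      simp [hi', pow_succ]
    · simp [h, hi', pow_succ, Finset.mem_insert]
  · intro s _ _ h
    by_cases h' : i ∈ s
    · rw [if_pos h'] at h
      exact Finset.notMem_erase i s (h.symm ▸ h')
    · rw [if_neg h'] at h
      exact h' (h ▸ Finset.mem_insert_self i s)
  · intro s _
    by_cases h : i ∈ s <;> simp [h]

/-- A symmetric multilinear map which vanishes on the diagonal vanishes. -/
lemma MultilinearMap.eq_zero_of_diagonal {n : ℕ} (f : MultilinearMap ℂ (fun _ : Fin n => V) W)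
    (hs : ∀ (σ : Equiv.Perm (Fin n)) (v : Fin n → V), f (v ∘ σ) = f v)
    (h0 : ∀ x : V, f (fun _ => x) = 0) (v : Fin n → V) : f v = 0 := by
  -- This is the diagonal value at `∑_{i ∈ s} v i`, expanded by multilinearity; the alternating sum
  -- over `s` then isolates the surjective `r`.
  have h1 : ∀ s : Finset (Fin n),
      ∑ r : Fin n → Fin n, (∏ j, (if r j ∈ s then (1 : ℂ) else 0)) • f (v ∘ r) = 0 := by
    intro s
    rw [← h0 (∑ i, (if i ∈ s then (1 : ℂ) else 0) • v i), MultilinearMap.map_sum]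
    refine Finset.sum_congr rfl fun r _ => ?_
    rw [MultilinearMap.map_smul_univ]
    rfl
  have h2 : ∑ r : Fin n → Fin n,
      (∑ s : Finset (Fin n), (-1 : ℂ) ^ s.card * ∏ j, (if r j ∈ s then (1 : ℂ) else 0)) •
        f (v ∘ r) = 0 := by
    simp only [Finset.sum_smul, mul_smul]
    rw [Finset.sum_comm]
    simp only [← Finset.smul_sum, h1, smul_zero, Finset.sum_const_zero]
  have h3 : ∀ r : Fin n → Fin n,
      (∑ s : Finset (Fin n), (-1 : ℂ) ^ s.card * ∏ j, (if r j ∈ s then (1 : ℂ) else 0)) •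
        f (v ∘ r) = (if Function.Surjective r then (-1 : ℂ) ^ n else 0) • f v := by
    intro r
    by_cases hr : Function.Surjective r
    · have hb : Function.Bijective r := Finite.surjective_iff_bijective.1 hr
      rw [if_pos hr, Finset.sum_eq_single Finset.univ]
      · rw [show f (v ∘ r) = f v from hs (Equiv.ofBijective r hb) v]
        simp
      -- For surjective `r`, any `s` other than the full set misses some value `r j`, which kills
      -- the product.
      · intro s _ hne
        obtain ⟨i, hi⟩ : ∃ i, i ∉ s := by
          by_contra! h
          exact hne (Finset.eq_univ_iff_forall.2 h)
        obtain ⟨j, rfl⟩ := hr i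
        rw [Finset.prod_eq_zero (Finset.mem_univ j) (by simp [hi]), mul_zero]
      · simp
    · rw [sum_neg_one_pow_card_mul_prod_ite_eq_zero hr, if_neg hr, zero_smul, zero_smul]
  simp only [h3] at h2
  rw [← Finset.sum_smul, smul_eq_zero] at h2
  refine h2.resolve_left ?_
  -- The coefficient of `f v` is `(-1)^n` times the number of surjections, which is positive because
  -- the identity is one.
  rw [← Finset.sum_filter, Finset.sum_const, nsmul_eq_mul]
  refine mul_ne_zero (Nat.cast_ne_zero.2 (Finset.card_ne_zero.2 ⟨id, ?_⟩)) (by simp)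
  simpa using Function.surjective_id

end Polarization

/-! ### Sums over ordered decompositions -/

section Antidiagonal

variable {W : Type*} [AddCommGroup W]

/-- Reindexing behind the shift of one factor in a Leibniz rule: adding `e` in slot `j` is injective
on decompositions of `d`, and its image consists of the decompositions of `d + e` whose slot `j`
dominates `e`. The others contribute nothing by `hg`. -/
lemma sum_piAntidiag_add {n : ℕ} (d e : Fin 2 →₀ ℕ) (j : Fin n)
    (g : (Fin n → Fin 2 →₀ ℕ) → W) (hg : ∀ p, ¬ e ≤ p j → g p = 0) :
    ∑ p ∈ Finset.piAntidiag Finset.univ (d + e), g p =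
      ∑ p ∈ Finset.piAntidiag Finset.univ d, g (Function.update p j (p j + e)) := by
  have hsum : ∀ (p : Fin n → Fin 2 →₀ ℕ) (x : Fin 2 →₀ ℕ),
      ∑ i, Function.update p j x i + p j = ∑ i, p i + x := by
    intro p x
    rw [Finset.sum_update_of_mem (Finset.mem_univ j), ← Finset.sum_sdiff (Finset.subset_univ {j})]
    simp only [Finset.sum_singleton]
    abel
  symm
  refine Finset.sum_of_injOn (fun p => Function.update p j (p j + e)) ?_ ?_ ?_ (fun _ _ => rfl)
  · intro p _ q _ h
    funext i
    have hi := congrFun h i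
    by_cases hij : i = j
    · subst hij
      simpa using hi
    · simpa [hij] using hi
  · intro p hp
    simp only [Finset.mem_coe, Finset.mem_piAntidiag, Finset.mem_univ,
      implies_true, and_true] at hp ⊢
    have h := hsum p (p j + e)
    rw [hp] at h
    refine add_right_cancel (b := p j) ?_
    rw [h]
    abel
  · intro p hp hne
    refine hg p fun hle => hne ⟨Function.update p j (p j - e), ?_, ?_⟩
    · simp only [Finset.mem_coe, Finset.mem_piAntidiag, Finset.mem_univ,
        implies_true, and_true] at hp ⊢
      have h := hsum p (p j - e)
      rw [hp] at h
      refine add_right_cancel (b := p j) ?_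
      rw [h, add_assoc, add_tsub_cancel_of_le hle]
    · simp [tsub_add_cancel_of_le hle]

/-- An empty slot can be deleted without changing the total. This lowers the number of factors by
one when the constant `J` occupies that slot. -/
lemma sum_piAntidiag_ite_zero {n : ℕ} (d : Fin 2 →₀ ℕ) (j : Fin (n + 1))
    (g : (Fin (n + 1) → Fin 2 →₀ ℕ) → W) :
    ∑ p ∈ Finset.piAntidiag Finset.univ d, (if p j = 0 then g p else 0) =
      ∑ p ∈ Finset.piAntidiag (Finset.univ : Finset (Fin n)) d, g (j.insertNth 0 p) := by
  symm
  refine Finset.sum_of_injOn (fun p => (j.insertNth 0 p : Fin (n + 1) → Fin 2 →₀ ℕ))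
    (Fin.insertNth_right_injective (α := fun _ => Fin 2 →₀ ℕ) 0).injOn ?_ ?_ ?_
  · intro p hp
    simp only [Finset.mem_coe, Finset.mem_piAntidiag, Finset.mem_univ,
      implies_true, and_true] at hp ⊢
    rw [Fin.sum_univ_succAbove _ j]
    simpa using hp
  · intro p hp hne
    refine if_neg fun h0 => hne ⟨fun i => p (j.succAbove i), ?_, ?_⟩
    · simp only [Finset.mem_coe, Finset.mem_piAntidiag, Finset.mem_univ,
        implies_true, and_true] at hp ⊢
      rwa [Fin.sum_univ_succAbove _ j, h0, zero_add] at hp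
    · exact (Fin.insertNth_eq_iff (α := fun _ => Fin 2 →₀ ℕ)).2 ⟨h0.symm, rfl⟩
  · intro p _
    simp

/-- Pigeonhole on the total degree. It is what makes the S-matrix of a series without constant term
finite at each multi-index. -/
lemma exists_eq_zero_of_mem_piAntidiag {n : ℕ} {d : Fin 2 →₀ ℕ} (hn : d.degree < n)
    {p : Fin n → Fin 2 →₀ ℕ} (hp : p ∈ Finset.piAntidiag Finset.univ d) : ∃ i, p i = 0 := by
  by_contra! h
  have h1 : ∑ i, p i = d := (Finset.mem_piAntidiag.1 hp).1
  have h2 : d.degree = ∑ i, (p i).degree := by rw [← h1, map_sum]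
  have h3 : ∑ _i : Fin n, 1 ≤ ∑ i, (p i).degree := Finset.sum_le_sum fun i _ =>
    Nat.one_le_iff_ne_zero.2 fun h0 => h i ((Finsupp.degree_eq_zero_iff _).1 h0)
  simp at h3
  omega

end Antidiagonal

/-! ### The order in `t` of an S-matrix -/

section Expansion

variable {V X K : Type*} [AddCommGroup V] [Module ℂ V] [Field K] [Algebra ℂ K]

/-- The sum over the slots of a multilinear map of the insertion of `D` into that slot. -/
def insertSum {n : ℕ} (f : MultilinearMap ℂ (fun _ : Fin n => V) (X → K)) (D : V →ₗ[ℂ] V) :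
    MultilinearMap ℂ (fun _ : Fin n => V) (X → K) :=
  ∑ j, f.compLinearMap (Function.update (fun _ => LinearMap.id) j D)

lemma insertSum_apply {n : ℕ} (f : MultilinearMap ℂ (fun _ : Fin n => V) (X → K))
    (D : V →ₗ[ℂ] V) (v : Fin n → V) :
    insertSum f D v = ∑ j, f (Function.update v j (D (v j))) := by
  simp only [insertSum, sum_apply, MultilinearMap.compLinearMap_apply]
  refine Finset.sum_congr rfl fun j _ => congrArg f ?_
  funext i
  by_cases h : i = j
  · subst h
    simp
  · simp [h]

/-! ### Symmetry under permutations of the slots -/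

lemma update_comp_perm {ι α : Type*} [DecidableEq ι] (v : ι → α) (σ : Equiv.Perm ι) (j : ι)
    (x : α) : Function.update (v ∘ σ) j x = Function.update v (σ j) x ∘ σ := by
  funext i
  by_cases h : i = j
  · subst h
    simp
  · simp [h]

lemma insertSum_symm {n : ℕ} {f : MultilinearMap ℂ (fun _ : Fin n => V) (X → K)}
    (hs : ∀ (σ : Equiv.Perm (Fin n)) (v : Fin n → V), f (v ∘ σ) = f v) (D : V →ₗ[ℂ] V)
    (σ : Equiv.Perm (Fin n)) (v : Fin n → V) : insertSum f D (v ∘ σ) = insertSum f D v := by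
  simp only [insertSum_apply, update_comp_perm, hs]
  exact Equiv.sum_comp σ fun j => f (Function.update v j (D (v j)))

lemma symm_update_const {n : ℕ} {f : MultilinearMap ℂ (fun _ : Fin (n + 1) => V) (X → K)}
    (hs : ∀ (σ : Equiv.Perm (Fin (n + 1))) (v : Fin (n + 1) → V), f (v ∘ σ) = f v) (x y : V)
    (j : Fin (n + 1)) :
    f (Function.update (fun _ => x) j y) = f (Fin.cons y fun _ : Fin n => x) := by
  rw [← hs (Equiv.swap 0 j) (Function.update (fun _ => x) j y)]
  congr 1
  funext i
  refine Fin.cases ?_ (fun i => ?_) i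
  · simp
  · have h : Equiv.swap 0 j i.succ ≠ j := fun h =>
      Fin.succ_ne_zero i ((Equiv.swap 0 j).injective (h.trans (Equiv.swap_apply_left 0 j).symm))
    simp [h]

lemma symm_insertNth {n : ℕ} {f : MultilinearMap ℂ (fun _ : Fin (n + 1) => V) (X → K)}
    (hs : ∀ (σ : Equiv.Perm (Fin (n + 1))) (v : Fin (n + 1) → V), f (v ∘ σ) = f v) (y : V)
    (v : Fin n → V) (j : Fin (n + 1)) :
    f (j.insertNth y v : Fin (n + 1) → V) = f (Fin.cons y v) := by
  rw [← hs j.cycleRange.symm (j.insertNth y v : Fin (n + 1) → V)]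
  congr 1
  funext i
  refine Fin.cases ?_ (fun i => ?_) i
  · simp
  · simp

lemma cons_comp_perm {n : ℕ} {f : MultilinearMap ℂ (fun _ : Fin (n + 1) => V) (X → K)}
    (hs : ∀ (σ : Equiv.Perm (Fin (n + 1))) (v : Fin (n + 1) → V), f (v ∘ σ) = f v) (y : V)
    (v : Fin n → V) (σ : Equiv.Perm (Fin n)) :
    f.curryLeft y (v ∘ σ) = f.curryLeft y v := by
  simp only [MultilinearMap.curryLeft_apply]
  -- This permutation fixes `0` and acts as `σ` on the successors.
  rw [← hs (Equiv.Perm.decomposeFin.symm (0, σ)) (Fin.cons y v)]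
  congr 1
  funext i
  refine Fin.cases ?_ (fun i => ?_) i
  · simp
  · simp

/-! ### The Leibniz rule on coefficients -/

/-- The factor `d 1 + 1` is the `t`-degree of the product, hence the sum of the `t`-degrees of its
factors. Distributing it over the slots and lowering the degree of slot `j` replaces that factor by
its `t`-derivative, to which `hG` applies. As `J` is constant in `λ` and `t`, it appears only where
the slot has multi-index `0`. -/
lemma smul_sum_piAntidiag {n : ℕ} (f : MultilinearMap ℂ (fun _ : Fin n => V) (X → K))
    (D : V →ₗ[ℂ] V) (J : V) {G : (Fin 2 →₀ ℕ) → V}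
    (hG : ∀ q, ((q 1 + 1 : ℕ) : ℂ) • G (q + Finsupp.single 1 1) =
      D (G q) - if q = 0 then J else 0) (d : Fin 2 →₀ ℕ) :
    ((d 1 + 1 : ℕ) : ℂ) • ∑ p ∈ Finset.piAntidiag Finset.univ (d + Finsupp.single 1 1),
        f (fun j => G (p j)) =
      ∑ p ∈ Finset.piAntidiag Finset.univ d, insertSum f D (fun j => G (p j)) -
      ∑ j, ∑ p ∈ Finset.piAntidiag Finset.univ d,
        if p j = 0 then f (Function.update (fun i => G (p i)) j J) else 0 := by
  have h1 : ∀ p ∈ Finset.piAntidiag (Finset.univ : Finset (Fin n)) (d + Finsupp.single 1 1),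
      ((d 1 + 1 : ℕ) : ℂ) • f (fun j => G (p j)) =
        ∑ j, ((p j 1 : ℕ) : ℂ) • f (fun j => G (p j)) := by
    intro p hp
    have hsum := DFunLike.congr_fun (Finset.mem_piAntidiag.1 hp).1 1
    rw [Finsupp.finsetSum_apply] at hsum
    simp only [Finsupp.add_apply, Finsupp.single_eq_same] at hsum
    rw [← Finset.sum_smul, ← hsum, Nat.cast_sum]
  rw [Finset.smul_sum, Finset.sum_congr rfl h1, Finset.sum_comm]
  simp only [insertSum_apply]
  rw [Finset.sum_comm (s := Finset.piAntidiag Finset.univ d), ← Finset.sum_sub_distrib]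
  refine Finset.sum_congr rfl fun j _ => ?_
  rw [sum_piAntidiag_add d (Finsupp.single 1 1) j, ← Finset.sum_sub_distrib]
  · refine Finset.sum_congr rfl fun p _ => ?_
    have h2 : (fun i => G (Function.update p j (p j + Finsupp.single 1 1) i)) =
        Function.update (fun i => G (p i)) j (G (p j + Finsupp.single 1 1)) := by
      funext i
      by_cases h : i = j
      · subst h
        simp
      · simp [h]
    rw [h2, ← MultilinearMap.map_update_smul]
    simp only [Function.update_self, Finsupp.add_apply, Finsupp.single_eq_same]
    rw [hG, MultilinearMap.map_update_sub]
    split_ifs with h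
    · rfl
    · simp
  -- A decomposition whose slot `j` contains no power of `t` carries the weight `p j 1 = 0`.
  · intro p hp
    have h0 : p j 1 = 0 := by
      by_contra h
      refine hp fun i => ?_
      by_cases hi : i = 1
      · subst hi
        simpa using Nat.one_le_iff_ne_zero.2 h
      · simp [Ne.symm hi]
    simp [h0]

/-- By symmetry `J` may be moved to the front from any of the `n + 1` slots, so all slots contribute
equally. -/
lemma sum_piAntidiag_update {n : ℕ} {f : MultilinearMap ℂ (fun _ : Fin (n + 1) => V) (X → K)}
    (hs : ∀ (σ : Equiv.Perm (Fin (n + 1))) (v : Fin (n + 1) → V), f (v ∘ σ) = f v)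
    (J : V) (G : (Fin 2 →₀ ℕ) → V) (d : Fin 2 →₀ ℕ) :
    (∑ j, ∑ p ∈ Finset.piAntidiag Finset.univ d,
        if p j = 0 then f (Function.update (fun i => G (p i)) j J) else 0) =
      (n + 1) • ∑ p ∈ Finset.piAntidiag Finset.univ d, f.curryLeft J (fun j => G (p j)) := by
  have h : ∀ j : Fin (n + 1), (∑ p ∈ Finset.piAntidiag Finset.univ d,
      if p j = 0 then f (Function.update (fun i => G (p i)) j J) else 0) =
      ∑ p ∈ Finset.piAntidiag Finset.univ d, f.curryLeft J (fun j => G (p j)) := by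
    intro j
    rw [sum_piAntidiag_ite_zero d j fun p => f (Function.update (fun i => G (p i)) j J)]
    refine Finset.sum_congr rfl fun p _ => ?_
    rw [MultilinearMap.curryLeft_apply, ← symm_insertNth hs J _ j]
    congr 1
    symm
    refine (Fin.insertNth_eq_iff (α := fun _ => V)).2 ⟨by simp, ?_⟩
    funext i
    simp [Fin.removeNth]
  simp [h]

/-- Exchanges a factor counting equivalent slots for one power of `i/ħ`; this matches `T_{n+1}` with
an insertion against `T_n` without it. -/
lemma ScalarQED.prefactor_succ_mul (ħ : K) (n : ℕ) :
    ScalarQED.prefactor ħ (n + 1) * ((n + 1 : ℕ) : K) =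
      ScalarQED.prefactor ħ n * (algebraMap ℂ K Complex.I / ħ) := by
  have : CharZero K := charZero_of_injective_algebraMap (algebraMap ℂ K).injective
  have h1 : ((n ! : ℕ) : K) ≠ 0 := Nat.cast_ne_zero.2 (Nat.factorial_ne_zero n)
  have h2 : ((n + 1 : ℕ) : K) ≠ 0 := Nat.cast_ne_zero.2 (Nat.succ_ne_zero n)
  simp only [ScalarQED.prefactor, Nat.factorial_succ, Nat.cast_mul, pow_succ]
  field_simp

/-- The derivative with respect to the second parameter of the formal S-matrix of a series `G`
with `∂_t G = D G - J`. -/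
lemma smul_coeff_succ (T : (n : ℕ) → MultilinearMap ℂ (fun _ : Fin n => V) (X → K))
    (hs : ∀ (n : ℕ) (σ : Equiv.Perm (Fin n)) (v : Fin n → V), T n (v ∘ σ) = T n v)
    (ħ : K) (D : V →ₗ[ℂ] V) (J : V) {G : (Fin 2 →₀ ℕ) → V} (hG0 : G 0 = 0)
    (hG : ∀ q, ((q 1 + 1 : ℕ) : ℂ) • G (q + Finsupp.single 1 1) =
      D (G q) - if q = 0 then J else 0) (d : Fin 2 →₀ ℕ) :
    ((d 1 + 1 : ℕ) : ℂ) • ∑ n ∈ Finset.Icc 1 (d + Finsupp.single 1 1).degree,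
        ScalarQED.prefactor ħ n •
          ∑ p ∈ Finset.piAntidiag Finset.univ (d + Finsupp.single 1 1), T n (fun j => G (p j)) =
      ∑ n ∈ Finset.range (d.degree + 1), ScalarQED.prefactor ħ n •
        ∑ p ∈ Finset.piAntidiag Finset.univ d,
          (insertSum (T n) D (fun j => G (p j)) -
            (algebraMap ℂ K Complex.I / ħ) • (T (n + 1)).curryLeft J (fun j => G (p j))) := by
  have hdeg : (d + Finsupp.single 1 1 : Fin 2 →₀ ℕ).degree = d.degree + 1 := by
    simp [map_add]
  have hterm : ∀ n : ℕ, ((d 1 + 1 : ℕ) : ℂ) • (ScalarQED.prefactor ħ (n + 1) •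
      ∑ p ∈ Finset.piAntidiag Finset.univ (d + Finsupp.single 1 1),
        T (n + 1) (fun j => G (p j))) =
      ScalarQED.prefactor ħ (n + 1) • ∑ p ∈ Finset.piAntidiag Finset.univ d,
        insertSum (T (n + 1)) D (fun j => G (p j)) -
      ScalarQED.prefactor ħ n • ∑ p ∈ Finset.piAntidiag Finset.univ d,
        (algebraMap ℂ K Complex.I / ħ) • (T (n + 1)).curryLeft J (fun j => G (p j)) := by
    intro n
    rw [smul_comm, smul_sum_piAntidiag (T (n + 1)) D J hG, sum_piAntidiag_update (hs (n + 1)),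
      smul_sub, ← Finset.smul_sum, smul_smul (ScalarQED.prefactor ħ n), ← ScalarQED.prefactor_succ_mul, mul_smul,
      Nat.cast_smul_eq_nsmul]
  have hIcc : ∀ (N : ℕ) (u : ℕ → X → K), ∑ n ∈ Finset.Icc 1 (N + 1), u n =
      ∑ n ∈ Finset.range (N + 1), u (n + 1) := by
    intro N u
    rw [Finset.range_eq_Ico, Finset.sum_Ico_add']
    rfl
  rw [hdeg, hIcc, Finset.smul_sum]
  simp only [hterm, Finset.sum_sub_distrib, smul_sub]
  congr 1
  -- The `D`-terms run over `1 ≤ n ≤ |d| + 1`, the `J`-terms over `0 ≤ n ≤ |d|`. The ranges are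
  -- aligned because `u` vanishes at both ends: for `n = 0` there is no slot to insert into, and for
  -- `n = |d| + 1` some slot carries `G 0 = 0`.
  set u : ℕ → X → K := fun n => ScalarQED.prefactor ħ n •
    ∑ p ∈ Finset.piAntidiag Finset.univ d, insertSum (T n) D (fun j => G (p j)) with hu
  have h0 : u 0 = 0 := by
    simp [hu, insertSum]
  have hlast : u (d.degree + 1) = 0 := by
    simp only [hu]
    rw [Finset.sum_eq_zero, smul_zero]
    intro p hp
    obtain ⟨i, hi⟩ := exists_eq_zero_of_mem_piAntidiag (Nat.lt_succ_self _) hp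
    exact MultilinearMap.map_coord_zero _ i (by rw [hi, hG0])
  have e1 := Finset.sum_range_succ u (d.degree + 1)
  have e2 := Finset.sum_range_succ' u (d.degree + 1)
  rw [hlast, add_zero] at e1
  rw [h0, add_zero] at e2
  exact e2.symm.trans e1

end Expansion

namespace ScalarQED

/-! ### The infinitesimal local `U(1)`-transformation of local fields -/

/-- The local field provided by `exists_local_derivative` serves all families with velocity `iαφ`.
Testing it on the linear family `c.shiftQ α (-s)`, whose velocity at `s = 0` is `-αQ = iαφ`,
identifies it with `-δ_{αQ}F`. -/
lemma hasDerivAt_neg_variation (α : TestR) (F : Floc) {c : ℝ → Config} {s : ℝ}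
    (hc : IsSmoothFamily c)
    (hd : ∀ x, HasDerivAt (fun r => (c r).h x) (Complex.I * (α x : ℂ) * (c s).h x) s) :
    HasDerivAt (fun r => F.1 (c r)) ((-variation α F).1 (c s)) s := by
  obtain ⟨G, -, h⟩ := exists_local_derivative α F.2
  have e : ∀ c, (-variation α F).1 c = G c := by
    intro c
    have h1 := h _ 0 (shiftQ_family α c) (hasDerivAt_shiftQ α c)
    simp only [neg_zero, shiftQ_zero] at h1
    have h2 := (HasDerivAt.scomp (0 : ℝ) (h := fun s : ℝ => -s)
      (g₁ := fun r => F.1 (c.shiftQ α (-r))) (by simpa using h1) (hasDerivAt_neg (0 : ℝ))).deriv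
    have h3 : deriv (fun s : ℝ => F.1 (c.shiftQ α s)) 0 = -G c := by
      simpa [Function.comp_def] using h2
    change -deriv (fun s : ℝ => F.1 (c.shiftQ α s)) 0 = G c
    rw [h3, neg_neg]
  rw [e]
  exact h c s hc hd

lemma hasDerivAt_transform (α : TestR) (F : Floc) (c : Config) (t : ℝ) :
    HasDerivAt (fun t : ℝ => transform (t • α) F.1 c)
      (transform (t • α) (-variation α F).1 c) t :=
  hasDerivAt_neg_variation α F (rotate_family α c) (hasDerivAt_rotate α c t)

lemma hasDerivAt_transform_zero (α : TestR) (F : Floc) (c : Config) :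
    HasDerivAt (fun t : ℝ => transform (t • α) F.1 c) ((-variation α F).1 c) 0 := by
  simpa only [transform, zero_smul, rotate_zero] using hasDerivAt_transform α F c 0

/-- The infinitesimal local transformation `F ↦ -δ_{αQ} F`, as a linear map on local fields. -/
noncomputable def localDeriv (α : TestR) : Floc →ₗ[ℂ] Floc where
  toFun F := -variation α F
  map_add' F G := Subtype.ext <| funext fun c =>
    (hasDerivAt_transform_zero α (F + G) c).unique
      ((hasDerivAt_transform_zero α F c).add (hasDerivAt_transform_zero α G c))
  map_smul' z F := Subtype.ext <| funext fun c =>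
    (hasDerivAt_transform_zero α (z • F) c).unique
      ((hasDerivAt_transform_zero α F c).const_mul z)

lemma localDeriv_apply (α : TestR) (F : Floc) : localDeriv α F = -variation α F := rfl

lemma localDeriv_eq (α : TestR) (F G : Floc)
    (h : ∀ c, HasDerivAt (fun t : ℝ => F.1 (c.rotate (t • α))) (G.1 c) 0) :
    localDeriv α F = G :=
  Subtype.ext <| funext fun c => (hasDerivAt_transform_zero α F c).unique (h c)

lemma iteratedDeriv_transform (α : TestR) (F : Floc) (c : Config) (k : ℕ) :
    iteratedDeriv k (fun t : ℝ => transform (t • α) F.1 c) =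
      fun t : ℝ => transform (t • α) ((localDeriv α ^ k) F).1 c := by
  induction k with
  | zero => simp
  | succ k ih =>
    rw [iteratedDeriv_succ, ih, pow_succ']
    funext t
    exact (hasDerivAt_transform α _ c t).deriv

/-- This is `F_{tα} = e^{tD}F`, read off coefficientwise. -/
lemma transformTerm_eq (F : Floc) (α : TestR) (k : ℕ) :
    transformTerm F α k = (k ! : ℂ)⁻¹ • (localDeriv α ^ k) F := by
  refine Subtype.ext <| funext fun c => ?_
  change taylorCoeff k (fun t => transform (t • α) F.1 c) = (k ! : ℂ)⁻¹ * _
  rw [taylorCoeff, iteratedDeriv_transform, div_eq_inv_mul]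
  simp only [transform, zero_smul, rotate_zero]

lemma transformTerm_zero (F : Floc) (α : TestR) : transformTerm F α 0 = F := by
  simp [transformTerm_eq]

lemma smul_transformTerm_succ (F : Floc) (α : TestR) (k : ℕ) :
    ((k + 1 : ℕ) : ℂ) • transformTerm F α (k + 1) = localDeriv α (transformTerm F α k) := by
  rw [transformTerm_eq, transformTerm_eq, map_smul, pow_succ', smul_smul]
  congr 1
  have h1 : ((k + 1 : ℕ) : ℂ) ≠ 0 := Nat.cast_ne_zero.2 (Nat.succ_ne_zero k)
  rw [Nat.factorial_succ, Nat.cast_mul, mul_inv, mul_inv_cancel_left₀ h1]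

/-! ### The variation of the free Lagrangian -/

/-- The local field `∫ dx ∂_μ α ∂^μ α φ* φ`. -/
noncomputable def quadraticField (α : TestR) : Floc := ⟨_, quadratic_mem α⟩

lemma deltaL_smul_eq (m t : ℝ) (α : TestR) (c : Config) :
    deltaL m (t • α) c = (t : ℂ) * -(divCurrent α).1 c + (t : ℂ) ^ 2 * (quadraticField α).1 c :=
  deltaL_smul m t α c

lemma hasDerivAt_quadratic (a b e : ℂ) (t : ℝ) :
    HasDerivAt (fun t : ℝ => a + (t : ℂ) * b + (t : ℂ) ^ 2 * e) (b + (t : ℂ) * (2 * e)) t := by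
  have h1 : HasDerivAt (fun t : ℝ => (t : ℂ)) 1 t := (hasDerivAt_id t).ofReal_comp
  refine (((hasDerivAt_const t a).add (h1.mul_const b)).add
    ((h1.pow 2).mul_const e)).congr_deriv ?_
  simp
  ring

lemma deriv_quadratic (a b e : ℂ) :
    deriv (fun t : ℝ => a + (t : ℂ) * b + (t : ℂ) ^ 2 * e) =
      fun t : ℝ => b + (t : ℂ) * (2 * e) + (t : ℂ) ^ 2 * 0 := by
  funext t
  rw [(hasDerivAt_quadratic a b e t).deriv, mul_zero, add_zero]

lemma iteratedDeriv_three_add_quadratic (k : ℕ) (a b e : ℂ) :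
    iteratedDeriv (k + 3) (fun t : ℝ => a + (t : ℂ) * b + (t : ℂ) ^ 2 * e) = 0 := by
  rw [iteratedDeriv_succ', iteratedDeriv_succ', iteratedDeriv_succ', deriv_quadratic,
    deriv_quadratic, deriv_quadratic]
  funext t
  simp

lemma deltaLTerm_apply (m : ℝ) (α : TestR) (k : ℕ) (c : Config) :
    (deltaLTerm m α k).1 c = iteratedDeriv k (fun t : ℝ => (0 : ℂ) + (t : ℂ) *
      -(divCurrent α).1 c + (t : ℂ) ^ 2 * (quadraticField α).1 c) 0 / (k ! : ℂ) := by
  simp only [deltaLTerm, taylorCoeff, deltaL_smul_eq, zero_add]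

lemma deltaLTerm_zero (m : ℝ) (α : TestR) : deltaLTerm m α 0 = 0 :=
  Subtype.ext <| funext fun c => by simp [deltaLTerm_apply]

lemma deltaLTerm_one (m : ℝ) (α : TestR) : deltaLTerm m α 1 = -divCurrent α :=
  Subtype.ext <| funext fun c => by
    rw [deltaLTerm_apply, iteratedDeriv_one, deriv_quadratic]
    simp

lemma deltaLTerm_two (m : ℝ) (α : TestR) : deltaLTerm m α 2 = quadraticField α :=
  Subtype.ext <| funext fun c => by
    rw [deltaLTerm_apply, iteratedDeriv_succ, iteratedDeriv_one, deriv_quadratic, deriv_quadratic]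
    simp

lemma deltaLTerm_add_three (m : ℝ) (α : TestR) (k : ℕ) : deltaLTerm m α (k + 3) = 0 :=
  Subtype.ext <| funext fun c => by
    rw [deltaLTerm_apply, iteratedDeriv_three_add_quadratic]
    simp

lemma star_exp_mul_exp (r : ℝ) :
    star (Complex.exp (Complex.I * (r : ℂ))) * Complex.exp (Complex.I * (r : ℂ)) = 1 := by
  rw [Complex.star_def, ← Complex.exp_conj, ← Complex.exp_add]
  simp

/-- The phases of `φ*` and `φ` cancel, and no derivative of the field occurs. -/
lemma quadraticField_rotate (α β : TestR) (c : Config) :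
    (quadraticField α).1 (c.rotate β) = (quadraticField α).1 c := by
  simp only [quadraticField, smear, map_mul, MvPolynomial.eval_X, Config.jet, Config.rotate,
    star_mul']
  congr 1
  funext x
  linear_combination (((∑ μ, metric μ * (pd μ α x * pd μ α x) : ℝ) : ℂ) *
    (star (c.h x) * c.h x)) * star_exp_mul_exp (β x)

/-- The two terms of the current each pick up `∂_μα φ*φ` from the derivative of the phase, with
equal signs; hence the factor 2. -/
lemma eval_current_rotate (α : TestR) (c : Config) (x : Mink) (μ : Fin 4) :
    MvPolynomial.eval ((c.rotate α).jet x) (current μ) =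
      MvPolynomial.eval (c.jet x) (current μ) + 2 * ((pd μ α x : ℝ) : ℂ) *
        MvPolynomial.eval (c.jet x) (MvPolynomial.X .phiStar * MvPolynomial.X .phi) := by
  simp only [current, map_mul, map_sub, MvPolynomial.eval_C, MvPolynomial.eval_X, Config.jet,
    pd_star, pd_rotate]
  simp only [Config.rotate, star_mul', star_add]
  have hI : star Complex.I = -Complex.I := Complex.conj_I
  have hr : star ((pd μ α x : ℝ) : ℂ) = ((pd μ α x : ℝ) : ℂ) := Complex.conj_ofReal _
  rw [hI, hr]
  linear_combination (Complex.I * (c.h x * (star (pd μ c.h x) +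
    -Complex.I * ((pd μ α x : ℝ) : ℂ) * star (c.h x)) - star (c.h x) * (pd μ c.h x +
    Complex.I * ((pd μ α x : ℝ) : ℂ) * c.h x))) * star_exp_mul_exp (α x) -
    2 * ((pd μ α x : ℝ) : ℂ) * (star (c.h x) * c.h x) * Complex.I_mul_I

lemma continuous_eval_jet (c : Config) (B : FieldPoly) :
    Continuous fun x => MvPolynomial.eval (c.jet x) B :=
  IsSmoothFamily.continuous_eval (c := fun _ => c)
    ⟨c.smooth_h.comp contDiff_snd, fun _ _ => rfl⟩ B 0

lemma divCurrent_rotate (α : TestR) (t : ℝ) (c : Config) :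
    (divCurrent α).1 (c.rotate (t • α)) =
      (divCurrent α).1 c - (t : ℂ) * (2 * (quadraticField α).1 c) := by
  have hcont : ∀ μ, Continuous fun x => pd μ α x := fun μ =>
    (contDiff_pd μ (TestR.smooth α)).continuous
  have hsupp : ∀ μ (f : Mink → ℂ), HasCompactSupport fun x => ((pd μ α x : ℝ) : ℂ) * f x :=
    fun μ f => ((hasCompactSupport_pd μ α.hasCompactSupport).comp_left
      Complex.ofReal_zero).mul_right
  have hint : ∀ μ (f : Mink → ℂ), Continuous f →
      MeasureTheory.Integrable fun x => ((pd μ α x : ℝ) : ℂ) * f x := fun μ f hf =>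
    ((Complex.continuous_ofReal.comp (hcont μ)).mul hf).integrable_of_hasCompactSupport (hsupp μ f)
  set B : FieldPoly := MvPolynomial.X .phiStar * MvPolynomial.X .phi with hB
  have hterm : ∀ μ, smear (current μ) (fun x => ((metric μ * pd μ α x : ℝ) : ℂ))
      (c.rotate (t • α)) = smear (current μ) (fun x => ((metric μ * pd μ α x : ℝ) : ℂ)) c +
        (t : ℂ) * (2 * ∫ x, ((metric μ * (pd μ α x * pd μ α x) : ℝ) : ℂ) *
          MvPolynomial.eval (c.jet x) B) := by
    intro μ
    have h1 := hint μ (fun x => (metric μ : ℂ) * MvPolynomial.eval (c.jet x) (current μ))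
      (continuous_const.mul (continuous_eval_jet c _))
    have h2 := hint μ (fun x => (t : ℂ) * 2 * (metric μ : ℂ) * ((pd μ α x : ℝ) : ℂ) *
      MvPolynomial.eval (c.jet x) B)
      ((continuous_const.mul (Complex.continuous_ofReal.comp (hcont μ))).mul
        (continuous_eval_jet c _))
    have h3 := MeasureTheory.integral_add h1 h2
    simp only [smear, eval_current_rotate, pd_smul]
    rw [← MeasureTheory.integral_const_mul, ← MeasureTheory.integral_const_mul]
    refine Eq.trans ?_ (h3.trans ?_)
    · congr 1
      funext x
      push_cast
      ring
    · congr 2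
      · funext x
        push_cast
        ring
      · funext x
        push_cast
        ring
  have hQ : (quadraticField α).1 c = ∑ μ, ∫ x, ((metric μ * (pd μ α x * pd μ α x) : ℝ) : ℂ) *
      MvPolynomial.eval (c.jet x) B := by
    rw [← MeasureTheory.integral_finsetSum]
    · simp only [quadraticField, smear, Complex.ofReal_sum, Finset.sum_mul, hB]
    · intro μ _
      have h := hint μ (fun x => (metric μ : ℂ) * ((pd μ α x : ℝ) : ℂ) *
        MvPolynomial.eval (c.jet x) B)
        ((continuous_const.mul (Complex.continuous_ofReal.comp (hcont μ))).mul
          (continuous_eval_jet c _))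
      refine h.congr (Filter.Eventually.of_forall fun x => ?_)
      push_cast
      ring
  rw [hQ]
  simp only [divCurrent, Pi.neg_apply, Finset.sum_apply, hterm, Finset.sum_add_distrib,
    Finset.mul_sum]
  ring

lemma localDeriv_quadraticField (α : TestR) : localDeriv α (quadraticField α) = 0 := by
  refine localDeriv_eq α _ _ fun c => ?_
  simp only [quadraticField_rotate]
  exact hasDerivAt_const _ _

lemma localDeriv_divCurrent (α : TestR) :
    localDeriv α (divCurrent α) = -((2 : ℂ) • quadraticField α) := by
  refine localDeriv_eq α _ _ fun c => ?_
  simp only [divCurrent_rotate]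
  -- `J` is affine in `t` along the rotation, so the quadratic coefficient is `0`.
  refine (hasDerivAt_quadratic ((divCurrent α).1 c) (-(2 * (quadraticField α).1 c)) 0
    0).congr_deriv ?_ |>.congr_of_eventuallyEq (Filter.Eventually.of_forall fun t => ?_)
  · simp
  · simp
    ring

/-- With `δL₀(tα) = -tJ + t²R`, order `0` gives `-J`, order `1` gives `2R = D(-J)`, order `2` gives
`D R = 0`, and nothing is left beyond. -/
lemma smul_deltaLTerm_succ (m : ℝ) (α : TestR) (k : ℕ) :
    ((k + 1 : ℕ) : ℂ) • deltaLTerm m α (k + 1) =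
      localDeriv α (deltaLTerm m α k) - if k = 0 then divCurrent α else 0 := by
  match k with
  | 0 => simp [deltaLTerm_zero, deltaLTerm_one]
  | 1 => simp [deltaLTerm_two, deltaLTerm_one, localDeriv_divCurrent]
  | 2 => simp [deltaLTerm_two, deltaLTerm_add_three m α 0, localDeriv_quadraticField]
  | k + 3 => simp [deltaLTerm_add_three]

/-! ### The differential equation of the transformed series -/

lemma transformedSeries_zero (m : ℝ) (F : Floc) (α : TestR) : transformedSeries m F α 0 = 0 := by
  simp [transformedSeries, deltaLTerm_zero]

lemma smul_transformedSeries_add_single (m : ℝ) (F : Floc) (α : TestR) (q : Fin 2 →₀ ℕ) :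
    ((q 1 + 1 : ℕ) : ℂ) • transformedSeries m F α (q + Finsupp.single 1 1) =
      localDeriv α (transformedSeries m F α q) - if q = 0 then divCurrent α else 0 := by
  have h0 : (q + Finsupp.single 1 1 : Fin 2 →₀ ℕ) 0 = q 0 := by simp
  have h1 : (q + Finsupp.single 1 1 : Fin 2 →₀ ℕ) 1 = q 1 + 1 := by simp
  have hq : q = 0 ↔ q 0 = 0 ∧ q 1 = 0 := by
    simp [Finsupp.ext_iff, Fin.forall_fin_two]
  simp only [transformedSeries, h0, h1]
  by_cases hz : q 0 = 0
  · simp only [hz, if_true, smul_deltaLTerm_succ, hq, true_and]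
  · have hq' : q ≠ 0 := fun h => hz (hq.1 h).1
    rw [if_neg hz, if_neg hz, if_neg hq', sub_zero]
    split_ifs
    · exact smul_transformTerm_succ F α _
    · simp

lemma transformedSeries_of_apply_one_eq_zero (m : ℝ) (F : Floc) (α : TestR) {q : Fin 2 →₀ ℕ}
    (hq : q 1 = 0) : transformedSeries m F α q = fieldSeries F q := by
  simp only [transformedSeries, fieldSeries, hq, deltaLTerm_zero, transformTerm_zero]
  split_ifs <;> simp_all

/-! ### The equivalence of the two identities -/

section

variable {K : Type*} [Field K] [Algebra ℂ K]

/-- The maps `T_n`, restricted to the solutions of the free field equations. -/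
noncomputable def TProduct.onShellT (T : TProduct K) (m : ℝ) (n : ℕ) :
    MultilinearMap ℂ (fun _ : Fin n => Floc) ({c : Config // c.IsFreeSolution m} → K) :=
  (LinearMap.funLeft ℂ K Subtype.val).compMultilinearMap (T.T n)

lemma TProduct.onShellT_apply (T : TProduct K) (m : ℝ) (n : ℕ) (F : Fin n → Floc) :
    T.onShellT m n F = onShell m (T.T n F) := rfl

lemma TProduct.onShellT_symm (T : TProduct K) (m : ℝ) (n : ℕ) (σ : Equiv.Perm (Fin n))
    (F : Fin n → Floc) : T.onShellT m n (F ∘ σ) = T.onShellT m n F := by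
  simp only [onShellT_apply, T.symm]

lemma TProduct.onShell_coeff_S (T : TProduct K) (ħ : K) (m : ℝ) (G : LocalSeries)
    (d : Fin 2 →₀ ℕ) :
    onShell m (MvPowerSeries.coeff d (T.S ħ G)) = (if d = 0 then 1 else 0) +
      ∑ n ∈ Finset.Icc 1 d.degree, prefactor ħ n •
        ∑ p ∈ Finset.piAntidiag (Finset.univ : Finset (Fin n)) d,
          T.onShellT m n fun j => G (p j) := by
  change onShell m (T.S ħ G d) = _
  funext c
  simp only [TProduct.S, onShell, Pi.add_apply, Finset.sum_apply, Pi.smul_apply,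
    TProduct.onShellT_apply]
  split_ifs <;> rfl

/-- The defect of the on-shell identity with insertion `j` of order `n`, as a multilinear map. -/
noncomputable def TProduct.defect (T : TProduct K) (ħ : K) (m : ℝ) (α : TestR) (n : ℕ) :
    MultilinearMap ℂ (fun _ : Fin n => Floc) ({c : Config // c.IsFreeSolution m} → K) :=
  insertSum (T.onShellT m n) (localDeriv α) -
    (algebraMap ℂ K Complex.I / ħ) • (T.onShellT m (n + 1)).curryLeft (divCurrent α)

lemma prefactor_ne_zero {ħ : K} (hħ : ħ ≠ 0) (n : ℕ) : prefactor ħ n ≠ 0 := by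
  have : CharZero K := charZero_of_injective_algebraMap (algebraMap ℂ K).injective
  refine div_ne_zero (pow_ne_zero _ (div_ne_zero ?_ hħ))
    (Nat.cast_ne_zero.2 (Nat.factorial_ne_zero n))
  simp

/-- The on-shell Master Ward Identity says that the defects vanish on the diagonal. -/
lemma onShellMWI_iff_defect {ħ : K} (hħ : ħ ≠ 0) (m : ℝ) (T : TProduct K) :
    OnShellMWI m ħ T ↔
      ∀ (F : Floc) (α : TestR) (n : ℕ), T.defect ħ m α n (fun _ => F) = 0 := by
  refine forall_congr' fun F => forall_congr' fun α => forall_congr' fun n => ?_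
  have ha : algebraMap ℂ K Complex.I / ħ ≠ 0 := div_ne_zero (by simp) hħ
  have hL : onShell m (PowerSeries.coeff n (T.insertion ħ (divCurrent α) F)) =
      prefactor ħ n • (T.onShellT m (n + 1)).curryLeft (divCurrent α) (fun _ => F) := by
    rw [TProduct.insertion, PowerSeries.coeff_mk]
    rfl
  have hR : (algebraMap ℂ K Complex.I / ħ) •
      onShell m (PowerSeries.coeff n (-(PowerSeries.X * T.insertion ħ (variation α F) F))) =
      prefactor ħ n • insertSum (T.onShellT m n) (localDeriv α) (fun _ => F) := by
    -- At order `0` both sides vanish: the factor `X` removes the constant term, and there is no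
    -- slot for `D`.
    cases n with
    | zero =>
      funext c
      simp [insertSum_apply, onShell]
    | succ n =>
      rw [map_neg, PowerSeries.coeff_succ_X_mul, TProduct.insertion, PowerSeries.coeff_mk,
        insertSum_apply]
      -- On the diagonal all `n + 1` insertions agree; their number turns `prefactor ħ (n + 1)` into
      -- `prefactor ħ n` times `i/ħ`.
      simp only [symm_update_const (T.onShellT_symm m (n + 1)), localDeriv_apply]
      have h := (T.onShellT m (n + 1)).cons_smul (fun _ => F) (-1) (variation α F)
      rw [neg_one_smul, neg_one_smul] at h
      rw [h, Finset.sum_const, Finset.card_univ, Fintype.card_fin,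
        ← Nat.cast_smul_eq_nsmul K, smul_smul, prefactor_succ_mul, mul_comm, mul_smul, smul_neg]
      rfl
  rw [hL, ← smul_right_injective _ ha |>.eq_iff]
  rw [hR, smul_comm, (smul_right_injective _ (prefactor_ne_zero hħ n)).eq_iff,
    TProduct.defect, sub_apply, smul_apply, sub_eq_zero, eq_comm]

lemma TProduct.defect_symm (T : TProduct K) (ħ : K) (m : ℝ) (α : TestR) (n : ℕ)
    (σ : Equiv.Perm (Fin n)) (F : Fin n → Floc) :
    T.defect ħ m α n (F ∘ σ) = T.defect ħ m α n F := by
  simp only [defect, sub_apply, smul_apply,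
    insertSum_symm (T.onShellT_symm m n), cons_comp_perm (T.onShellT_symm m (n + 1))]

lemma TProduct.smul_coeff_S_transformedSeries (T : TProduct K) (ħ : K) (m : ℝ) (F : Floc)
    (α : TestR) (d : Fin 2 →₀ ℕ) :
    ((d 1 + 1 : ℕ) : ℂ) • onShell m
        (MvPowerSeries.coeff (d + Finsupp.single 1 1) (T.S ħ (transformedSeries m F α))) =
      ∑ n ∈ Finset.range (d.degree + 1), prefactor ħ n •
        ∑ p ∈ Finset.piAntidiag (Finset.univ : Finset (Fin n)) d,
          T.defect ħ m α n fun j => transformedSeries m F α (p j) := by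
  have hd : d + Finsupp.single 1 1 ≠ 0 := fun h => by
    simpa using DFunLike.congr_fun h 1
  rw [T.onShell_coeff_S, if_neg hd, zero_add, smul_coeff_succ (T.onShellT m) (T.onShellT_symm m) ħ
    (localDeriv α) (divCurrent α) (transformedSeries_zero m F α)
    (smul_transformedSeries_add_single m F α)]
  rfl

/-- A coefficient of `S(λF)` of positive order in `α` vanishes. -/
lemma TProduct.coeff_S_fieldSeries (T : TProduct K) (ħ : K) (m : ℝ) (F : Floc)
    {d : Fin 2 →₀ ℕ} (hd : d 1 ≠ 0) :
    onShell m (MvPowerSeries.coeff d (T.S ħ (fieldSeries F))) = 0 := by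
  have hd0 : d ≠ 0 := fun h => hd (by simp [h])
  rw [T.onShell_coeff_S, if_neg hd0, zero_add]
  refine Finset.sum_eq_zero fun n _ => ?_
  rw [Finset.sum_eq_zero, smul_zero]
  intro p hp
  have h1 : ∑ i, p i 1 = d 1 := by
    rw [← Finsupp.finsetSum_apply, (Finset.mem_piAntidiag.1 hp).1]
  obtain ⟨i, -, hi⟩ := Finset.exists_ne_zero_of_sum_ne_zero (h1.symm ▸ hd)
  exact MultilinearMap.map_coord_zero _ i (if_neg fun h => hi h.2)

/-- To order zero in `α`, the transformed S-matrix is the untransformed one. -/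
lemma TProduct.coeff_S_transformedSeries (T : TProduct K) (ħ : K) (m : ℝ) (F : Floc) (α : TestR)
    {d : Fin 2 →₀ ℕ} (hd : d 1 = 0) :
    onShell m (MvPowerSeries.coeff d (T.S ħ (transformedSeries m F α))) =
      onShell m (MvPowerSeries.coeff d (T.S ħ (fieldSeries F))) := by
  rw [T.onShell_coeff_S, T.onShell_coeff_S]
  congr 1
  refine Finset.sum_congr rfl fun n _ => ?_
  congr 1
  refine Finset.sum_congr rfl fun p hp => ?_
  congr 1
  funext j
  refine transformedSeries_of_apply_one_eq_zero m F α ?_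
  have h1 : ∑ i, p i 1 = d 1 := by
    rw [← Finsupp.finsetSum_apply, (Finset.mem_piAntidiag.1 hp).1]
  rw [hd] at h1
  exact Finset.sum_eq_zero_iff.1 h1 j (Finset.mem_univ j)

/-- To first order in `α`, only the diagonal value of one defect contributes. -/
lemma TProduct.coeff_S_transformedSeries_single (T : TProduct K) (ħ : K) (m : ℝ) (F : Floc)
    (α : TestR) (n : ℕ) :
    onShell m (MvPowerSeries.coeff (Finsupp.single 0 n + Finsupp.single 1 1)
      (T.S ħ (transformedSeries m F α))) = prefactor ħ n • T.defect ħ m α n fun _ => F := by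
  have h := T.smul_coeff_S_transformedSeries ħ m F α (Finsupp.single 0 n)
  have h1 : (Finsupp.single (0 : Fin 2) n) 1 = 0 := by simp
  rw [h1, zero_add, Nat.cast_one, one_smul] at h
  -- At order `t⁰` the series is just `λF`, so a decomposition of `(n, 0)` survives only if every
  -- slot is `(1, 0)`, which forces `k = n`.
  have key : ∀ (k : ℕ) (p : Fin k → Fin 2 →₀ ℕ),
      p ∈ Finset.piAntidiag (Finset.univ : Finset (Fin k)) (Finsupp.single 0 n) →
      (k = n ∧ p = fun _ => Finsupp.single 0 1) ∨
      T.defect ħ m α k (fun j => transformedSeries m F α (p j)) = 0 := by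
    intro k p hp
    have hs := (Finset.mem_piAntidiag.1 hp).1
    have hp1 : ∀ j, p j 1 = 0 := fun j => by
      have h2 : ∑ i, p i 1 = 0 := by rw [← Finsupp.finsetSum_apply, hs, h1]
      exact Finset.sum_eq_zero_iff.1 h2 j (Finset.mem_univ j)
    by_cases hall : ∀ j, p j 0 = 1
    · left
      have hp' : p = fun _ => Finsupp.single 0 1 := by
        funext j
        ext i
        fin_cases i
        · simpa using hall j
        · simpa using hp1 j
      refine ⟨?_, hp'⟩
      have h2 := DFunLike.congr_fun hs 0
      rw [Finsupp.finsetSum_apply] at h2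
      simpa [hall] using h2
    · right
      obtain ⟨j, hj⟩ := not_forall.1 hall
      refine MultilinearMap.map_coord_zero _ j ?_
      rw [transformedSeries_of_apply_one_eq_zero m F α (hp1 j)]
      exact if_neg fun h => hj h.1
  rw [h, Finset.sum_eq_single n]
  · congr 1
    rw [Finset.sum_eq_single fun _ => Finsupp.single 0 1]
    · congr 1
      funext j
      rw [transformedSeries_of_apply_one_eq_zero m F α (by simp)]
      simp [fieldSeries]
    · intro p hp hne
      exact (key n p hp).resolve_left fun h => hne h.2
    · intro hn
      refine absurd ?_ hn
      simp [Finset.mem_piAntidiag]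
  · intro k _ hk
    rw [Finset.sum_eq_zero, smul_zero]
    exact fun p hp => (key k p hp).resolve_left fun h => hk h.1
  · intro hn
    refine absurd ?_ hn
    simp

end

end ScalarQED

theorem mainTheorem3 {K : Type*} [Field K] [Algebra ℂ K] (ħ : K) (hħ : ħ ≠ 0) (m : ℝ)
    (T : ScalarQED.TProduct K) :
    ScalarQED.UnitaryMWI m ħ T ↔ ScalarQED.OnShellMWI m ħ T := by
  rw [ScalarQED.onShellMWI_iff_defect hħ]
  constructor
  · intro h F α n
    have h1 := h F α (Finsupp.single 0 n + Finsupp.single 1 1)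
    rw [T.coeff_S_transformedSeries_single, T.coeff_S_fieldSeries ħ m F (by simp)] at h1
    exact (smul_eq_zero.1 h1).resolve_left (ScalarQED.prefactor_ne_zero hħ n)
  · intro h F α d
    by_cases hd : d 1 = 0
    · exact T.coeff_S_transformedSeries ħ m F α hd
    · rw [T.coeff_S_fieldSeries ħ m F hd]
      have hle : Finsupp.single 1 1 ≤ d := by
        rw [Finsupp.single_le_iff]
        exact Nat.one_le_iff_ne_zero.2 hd
      -- A coefficient of positive order in `t` is, up to the nonzero factor `e 1 + 1`, a
      -- coefficient of the `t`-derivative.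
      obtain ⟨e, rfl⟩ := exists_add_of_le hle
      rw [add_comm]
      have h1 := T.smul_coeff_S_transformedSeries ħ m F α e
      have h2 : ∀ (n : ℕ) (v : Fin n → ScalarQED.Floc), T.defect ħ m α n v = 0 := fun n =>
        (T.defect ħ m α n).eq_zero_of_diagonal (T.defect_symm ħ m α n) fun F => h F α n
      simp only [h2, Finset.sum_const_zero, smul_zero] at h1
      exact (smul_eq_zero.1 h1).resolve_left (Nat.cast_ne_zero.2 (Nat.succ_ne_zero _))
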